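/- Let $n\ge 0$ and let $\alpha,\beta>0$, $q\ge 0$ be real numbers. The ASEP on $n$ sites with parameters $\alpha,\beta,q$ and $\gamma=\delta=0$ is the continuous time Markov chain on $\{0,1\}^n$ (where $\eta(i)=1$ means that site $i$ is occupied by a particle and $\eta(i)=0$ that it is vacant) with the following transitions: a particle at site $i$ jumps to site $i+1$, if vacant, at rate $1$; a particle at site $i$ jumps to site $i-1$, if vacant, at rate $q$; a particle is created at site $1$, if vacant, at rate $\alpha$; a particle at site $n$ is annihilated at rate $\beta$. This chain has a unique stationary distribution $\mu$, and its multivariate partition function $$Z_\mu(x_1,\dots,x_n)=\sum_{\eta\in\{0,1\}^n}\mu(\eta)\,x_1^{\eta(1)}\cdots x_n^{\eta(n)}$$ is a (positive) constant multiple of $$\sum_{\pi\in\mathfrak S_{n+1}}\alpha^{-c(\pi)}\beta^{-c'(\pi)}q^{\mathrm{yy}(\pi)}\prod_{i\in\mathcal X(\pi)}x_i ,$$ with the convention $0^0=1$. Here, for a permutation $\pi$ of $\{1,\dots,n+1\}$: - $\mathcal X(\pi)=\{i\in\{1,\dots,n\} : \pi(i)>i\}$ is the excedance set; - $c(\pi)$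 is the number of cycles of $\pi$, fixed points included; - $c'(\pi)$ is the number of right-to-left minima (letters smaller than all letters to their right) of the word $W=\pi(s)\,\pi^2(s)\cdots\pi^{-1}(s)$, where $s=n+1$ and $Ws$ is the cycle of $\pi$ that contains $n+1$ ($W$ is empty if $n+1$ is a fixed point); - $\mathrm{yy}(\pi)$ is the number of yin-yang pairs of $\pi$, that is, of pairs $1\le i<j\le n$ with $p(j)<i<j<p(i)$, where $p(i)\in\{0,\dots,n+1\}$ is given as follows: $p(i)=0$ if $i$ is the largest element of its cycle; $p(i)=\max\{\pi(i),\dots,\pi^k(i)\}$ with $k+1=\min\{j>0 : \pi^j(i)\le i\}$ if $\pi(i)>i$; and $p(i)=\min\{\pi(i),\dots,\pi^k(i)\}$ with $k+1=\min\{j>0 : \pi^j(i)\ge i\}$ if $\pi(i)<i$ and $i$ is not the largest element of its cycle. -/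

import Mathlib

open scoped BigOperators

noncomputable section

namespace ExclusionProcess

/-- Particle configurations on `n` sites: `η i = true` means that site `i` is occupied. The sites
`1, …, n` are represented by `Fin n`, so `i : Fin n` is the site labelled `i + 1`. -/
abbrev Config (n : ℕ) : Type := Fin n → Bool

/-- The rate of the transition `η → η'` in the exclusion process with jump rates `Q`, birth rates
`b` and death rates `d`. Each summand vanishes unless the event in question is possible in the
configuration `η` and turns `η` into `η'`. -/
def transitionRate {n : ℕ} (Q : Fin n → Fin n → ℝ) (b d : Fin n → ℝ) (η η' : Config n) : ℝ :=
  (∑ i : Fin n, ∑ j : Fin n,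
      if η i = true ∧ η j = false ∧ η' = η ∘ Equiv.swap i j then Q i j else 0)
  + (∑ i : Fin n, if η i = false ∧ η' = Function.update η i true then b i else 0)
  + (∑ i : Fin n, if η i = true ∧ η' = Function.update η i false then d i else 0)

/-- The generator (rate matrix) of the continuous time Markov chain on `{0,1}ⁿ`: its rows sum to
zero. (A transition never leads from `η` to `η` itself.) -/
def generator {n : ℕ} (Q : Fin n → Fin n → ℝ) (b d : Fin n → ℝ) :
    Matrix (Config n) (Config n) ℝ :=
  Matrix.of (transitionRate Q b d)
    - Matrix.diagonal (fun η => ∑ η' : Config n, transitionRate Q b d η η')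

/-- A stationary distribution of the continuous time Markov chain with generator `G`: a probability
vector `μ` with `μ G = 0`. -/
def IsStationary {n : ℕ} (G : Matrix (Config n) (Config n) ℝ) (μ : Config n → ℝ) : Prop :=
  μ ∈ stdSimplex ℝ (Config n) ∧ Matrix.vecMul μ G = 0

/-- The jump rates of the ASEP on a line: rate `1` to the right neighbour, rate `q` to the left
neighbour. -/
def asepJump (n : ℕ) (q : ℝ) (i j : Fin n) : ℝ :=
  if (j : ℕ) = (i : ℕ) + 1 then 1 else if (i : ℕ) = (j : ℕ) + 1 then q else 0

/-- The birth rates of the ASEP: `α` at the first site, `δ` at the last site. -/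
def asepBirth (n : ℕ) (α δ : ℝ) (i : Fin n) : ℝ :=
  (if (i : ℕ) = 0 then α else 0) + (if (i : ℕ) + 1 = n then δ else 0)

/-- The death rates of the ASEP: `γ` at the first site, `β` at the last site. -/
def asepDeath (n : ℕ) (β γ : ℝ) (i : Fin n) : ℝ :=
  (if (i : ℕ) = 0 then γ else 0) + (if (i : ℕ) + 1 = n then β else 0)

/-- The generator of the ASEP on `n` sites with parameters `α, β, γ, δ, q`. -/
def asepGenerator (n : ℕ) (α β γ δ q : ℝ) : Matrix (Config n) (Config n) ℝ :=
  generator (asepJump n q) (asepBirth n α δ) (asepDeath n β γ)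

/-- The multivariate partition function `∑ η, μ(η) x₁^{η(1)} ⋯ xₙ^{η(n)}`. -/
def partitionFunction {n : ℕ} (μ : Config n → ℝ) : MvPolynomial (Fin n) ℝ :=
  ∑ η : Config n, MvPolynomial.C (μ η) * ∏ i : Fin n, MvPolynomial.X i ^ (η i).toNat

/-! Permutations of `{1, …, n+1}` are represented by `Equiv.Perm (Fin (n + 1))`; the element
`i : Fin (n + 1)` has label `i + 1`. In particular `Fin.last n` has label `n + 1`, and
`i.castSucc` for `i : Fin n` ranges over the elements with labels `1, …, n`. -/

/-- The excedance set, as a subset of `{1, …, n}`. -/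
def excedanceSet {n : ℕ} (π : Equiv.Perm (Fin (n + 1))) : Finset (Fin n) :=
  Finset.univ.filter (fun i => i.castSucc < π i.castSucc)

/-- The number of cycles of `π`, fixed points included. -/
def numCycles {n : ℕ} (π : Equiv.Perm (Fin (n + 1))) : ℕ :=
  Nat.card (Quotient (Equiv.Perm.SameCycle.setoid π))

/-- The number of right-to-left minima of a word: letters smaller than all letters to their
right. -/
def numRightToLeftMinima {m : ℕ} : List (Fin m) → ℕ
  | [] => 0
  | a :: w => (if ∀ x ∈ w, a < x then 1 else 0) + numRightToLeftMinima w

/-- The word `W` such that the cycle of `π` containing the largest element `s` is written `W s`,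
that is, `W = π(s) π²(s) ⋯ π⁻¹(s)`. (`π.toList s` is the word `s π(s) ⋯ π⁻¹(s)`, or the empty word
if `s` is a fixed point.) -/
def lastCycleWord {n : ℕ} (π : Equiv.Perm (Fin (n + 1))) : List (Fin (n + 1)) :=
  (π.toList (Fin.last n)).tail

/-- `c'(π)`. -/
def cPrime {n : ℕ} (π : Equiv.Perm (Fin (n + 1))) : ℕ :=
  numRightToLeftMinima (lastCycleWord π)

/-- The first time `j > 0` with `πʲ(i) ≤ i`. -/
def timeBelow {n : ℕ} (π : Equiv.Perm (Fin (n + 1))) (i : Fin (n + 1)) : ℕ :=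
  sInf {j : ℕ | 0 < j ∧ (π ^ j) i ≤ i}

/-- The first time `j > 0` with `πʲ(i) ≥ i`. -/
def timeAbove {n : ℕ} (π : Equiv.Perm (Fin (n + 1))) (i : Fin (n + 1)) : ℕ :=
  sInf {j : ℕ | 0 < j ∧ i ≤ (π ^ j) i}

open Classical in
/-- The label in `{0, …, n+1}` of the parent of `i` in the alternative tree of `π`, whose root
is `0`:
* `0`, if `i` is the largest element of its cycle;
* `max {π(i), …, πᵏ(i)}`, where `k + 1` is the first positive time `j` with `πʲ(i) ≤ i`,
  if `i < π(i)`;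
* `min {π(i), …, πᵏ(i)}`, where `k + 1` is the first positive time `j` with `πʲ(i) ≥ i`,
  if `i > π(i)` and `i` is not the largest element of its cycle. -/
def parent {n : ℕ} (π : Equiv.Perm (Fin (n + 1))) (i : Fin (n + 1)) : ℕ :=
  if ∀ j, π.SameCycle i j → j ≤ i then 0
  else if i < π i then
    sSup ((fun j : ℕ => (((π ^ j) i : Fin (n + 1)) : ℕ) + 1) '' Set.Ico 1 (timeBelow π i))
  else
    sInf ((fun j : ℕ => (((π ^ j) i : Fin (n + 1)) : ℕ) + 1) '' Set.Ico 1 (timeAbove π i))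

/-- The number of yin-yang pairs: pairs of labels `1 ≤ i < j ≤ n` with `p(j) < i < j < p(i)`. -/
def yinYang {n : ℕ} (π : Equiv.Perm (Fin (n + 1))) : ℕ :=
  ((Finset.univ : Finset (Fin n × Fin n)).filter (fun ij =>
    parent π ij.2.castSucc < (ij.1 : ℕ) + 1 ∧ ij.1 < ij.2 ∧
      (ij.2 : ℕ) + 1 < parent π ij.1.castSucc)).card

/-- The polynomial `∑ π ∈ S_{n+1}, α^{-c(π)} β^{-c'(π)} q^{yy(π)} ∏ i ∈ X(π), x_i`. -/
def permutationPolynomial (n : ℕ) (α β q : ℝ) : MvPolynomial (Fin n) ℝ :=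
  ∑ π : Equiv.Perm (Fin (n + 1)),
    MvPolynomial.C (α⁻¹ ^ numCycles π * β⁻¹ ^ cPrime π * q ^ yinYang π) *
      ∏ i ∈ excedanceSet π, MvPolynomial.X i

end ExclusionProcess

end

open scoped BigOperators

noncomputable section

namespace ExclusionProcess

/-! Let w(η) be the total weight of the permutations whose excedance set is the set of occupied
sites of η (`configWeight`). Sorting permutations by excedance set shows that the polynomial is the
partition function of w, so it suffices that w is positive and spans the left kernel of the
generator.

The weights satisfy three recursions in the number of sites. If the first site is vacant, 1 is a
fixed point of π, and deleting it removes one cycle: α w(η) = w(η without the first site). If the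
last site is occupied, π(n) = n+1, and deleting n removes one right-to-left minimum: β w(η) = w(η
without the last site). If a particle at P is followed by a hole at Q = P+1, split by π. When π(P) =
Q, delete P; when π(Q) = P and π(P) ≠ Q, delete Q; neither changes the statistics. Otherwise
conjugate by the transposition (P Q), which exchanges the two sites and destroys exactly one
yin-yang pair, (P, Q) itself. So w(η) = q w(η with P, Q exchanged) + w(η without P) + w(η without Q)
(`configWeight_true_false`).

Following the statistics through these operations is easier without parents: yin-yang pairs and
right-to-left minima are expressed by `Reach`, "the orbit enters B while staying in A", and one only
compares how A and B see the inserted or relabelled points.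

By the third recursion the net flow into η across a bond is a difference of signed weights with one
site deleted (`configWeight_bond`). These differences telescope, and the first two recursions make
the boundary flows cancel the two ends (`vecMul_configWeight`). Positivity of w follows by induction
from the same recursions. Uniqueness is a maximum principle for the ratio of a left null vector to
w, together with the fact that every configuration can be reached from the empty one. -/

/-- From `y` one can follow `π` through points satisfying `A` until a point satisfying `B`. -/
inductive Reach {ι : Type*} (π : Equiv.Perm ι) (A B : ι → Prop) : ι → Prop
  | done {y : ι} : B y → Reach π A B y
  | step {y : ι} : A (π y) → Reach π A B (π y) → Reach π A B y

/-! ### Yin-yang pairs and right-to-left minima as orbit conditions -/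

theorem reach_iff_pow {ι : Type*} {π : Equiv.Perm ι} {A B : ι → Prop} {y : ι} :
    Reach π A B y ↔ ∃ k : ℕ, B ((π ^ k) y) ∧ ∀ l, 1 ≤ l → l ≤ k → A ((π ^ l) y) := by
  constructor
  · intro h
    induction h with
    | done h => exact ⟨0, by simpa using h, fun l h1 h2 => by omega⟩
    | @step y hA _ ih =>
      obtain ⟨k, hk, hl⟩ := ih
      refine ⟨k + 1, by simpa [pow_succ] using hk, fun l h1 h2 => ?_⟩
      obtain ⟨l, rfl⟩ : ∃ l', l = l' + 1 := ⟨l - 1, by omega⟩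
      rcases Nat.eq_zero_or_pos l with rfl | hpos
      · simpa using hA
      · simpa [pow_succ] using hl l hpos (by omega)
  · rintro ⟨k, hk, hl⟩
    induction k generalizing y with
    | zero => exact .done (by simpa using hk)
    | succ k ih =>
      refine .step (by simpa using hl 1 le_rfl (by omega)) (ih ?_ fun l h1 h2 => ?_)
      · simpa [pow_succ] using hk
      · simpa [pow_succ] using hl (l + 1) (by omega) (by omega)

theorem Reach.sameCycle {ι : Type*} {π : Equiv.Perm ι} {A B : ι → Prop} {y : ι}
    (h : Reach π A B y) : ∃ z, π.SameCycle y z ∧ B z := by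
  obtain ⟨k, hk, -⟩ := reach_iff_pow.1 h
  exact ⟨_, ⟨k, by simp⟩, hk⟩

theorem Reach.first {ι : Type*} {π : Equiv.Perm ι} {A B : ι → Prop} {y : ι}
    (h : Reach π A B y) (hB : ¬ B y) : A (π y) := by
  cases h with
  | done h => exact absurd h hB
  | step h _ => exact h

/-- `a` is the largest element of its cycle. -/
def IsRoot {n : ℕ} (π : Equiv.Perm (Fin n)) (a : Fin n) : Prop := ∀ j, π.SameCycle a j → j ≤ a

theorem exists_pow_pos_fix {n : ℕ} (π : Equiv.Perm (Fin (n + 1))) (i : Fin (n + 1)) :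
    ∃ j, 0 < j ∧ (π ^ j) i = i :=
  ⟨orderOf π, orderOf_pos π, by simp [pow_orderOf_eq_one]⟩

theorem not_isRoot_of_lt {n : ℕ} {π : Equiv.Perm (Fin n)} {i : Fin n} (h : i < π i) :
    ¬ IsRoot π i := fun hr => absurd (hr (π i) ⟨1, by simp⟩) (not_le.2 h)

theorem lt_of_not_isRoot {n : ℕ} {π : Equiv.Perm (Fin n)} {i : Fin n} (h : ¬ IsRoot π i)
    (h' : ¬ i < π i) : π i < i := by
  refine lt_of_le_of_ne (not_lt.1 h') fun he => h fun j hj => ?_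
  exact (hj.eq_of_left he).ge

theorem timeBelow_spec {n : ℕ} (π : Equiv.Perm (Fin (n + 1))) (i : Fin (n + 1)) :
    0 < timeBelow π i ∧ (π ^ timeBelow π i) i ≤ i := by
  obtain ⟨j, hj, h⟩ := exists_pow_pos_fix π i
  exact Nat.sInf_mem (s := {j : ℕ | 0 < j ∧ (π ^ j) i ≤ i}) ⟨j, hj, h.le⟩

theorem timeAbove_spec {n : ℕ} (π : Equiv.Perm (Fin (n + 1))) (i : Fin (n + 1)) :
    0 < timeAbove π i ∧ i ≤ (π ^ timeAbove π i) i := by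
  obtain ⟨j, hj, h⟩ := exists_pow_pos_fix π i
  exact Nat.sInf_mem (s := {j : ℕ | 0 < j ∧ i ≤ (π ^ j) i}) ⟨j, hj, h.ge⟩

theorem lt_pow_of_lt_timeBelow {n : ℕ} {π : Equiv.Perm (Fin (n + 1))} {i : Fin (n + 1)} {l : ℕ}
    (h0 : 0 < l) (h : l < timeBelow π i) : i < (π ^ l) i := by
  by_contra hc
  exact Nat.notMem_of_lt_sInf h ⟨h0, not_lt.1 hc⟩

theorem pow_lt_of_lt_timeAbove {n : ℕ} {π : Equiv.Perm (Fin (n + 1))} {i : Fin (n + 1)} {l : ℕ}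
    (h0 : 0 < l) (h : l < timeAbove π i) : (π ^ l) i < i := by
  by_contra hc
  exact Nat.notMem_of_lt_sInf h ⟨h0, not_lt.1 hc⟩

theorem parent_of_isRoot {n : ℕ} {π : Equiv.Perm (Fin (n + 1))} {i : Fin (n + 1)}
    (h : IsRoot π i) : parent π i = 0 := if_pos h

theorem one_lt_timeBelow {n : ℕ} {π : Equiv.Perm (Fin (n + 1))} {i : Fin (n + 1)}
    (h : i < π i) : 1 < timeBelow π i := by
  obtain ⟨h0, h1⟩ := timeBelow_spec π i
  refine lt_of_le_of_ne h0 fun he => ?_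
  rw [← he] at h1
  exact absurd h (not_lt.2 (by simpa using h1))

theorem one_lt_timeAbove {n : ℕ} {π : Equiv.Perm (Fin (n + 1))} {i : Fin (n + 1)}
    (h : π i < i) : 1 < timeAbove π i := by
  obtain ⟨h0, h1⟩ := timeAbove_spec π i
  refine lt_of_le_of_ne h0 fun he => ?_
  rw [← he] at h1
  exact absurd h (not_lt.2 (by simpa using h1))

theorem lt_parent_iff {n : ℕ} {π : Equiv.Perm (Fin (n + 1))} {i : Fin (n + 1)} (h : i < π i)
    {a : ℕ} : a < parent π i ↔
      ∃ l, 1 ≤ l ∧ l < timeBelow π i ∧ a < (((π ^ l) i : Fin (n + 1)) : ℕ) + 1 := by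
  have hp : parent π i = sSup ((fun j : ℕ => (((π ^ j) i : Fin (n + 1)) : ℕ) + 1) ''
      Set.Ico 1 (timeBelow π i)) := by
    exact (if_neg (not_isRoot_of_lt h)).trans (if_pos h)
  rw [hp, lt_csSup_iff]
  · constructor
    · rintro ⟨_, ⟨l, hl, rfl⟩, h⟩
      exact ⟨l, hl.1, hl.2, h⟩
    · rintro ⟨l, h1, h2, h⟩
      exact ⟨_, ⟨l, ⟨h1, h2⟩, rfl⟩, h⟩
  · exact ((Set.finite_Ico _ _).image _).bddAbove
  · exact ⟨_, 1, ⟨le_rfl, one_lt_timeBelow h⟩, rfl⟩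

theorem parent_lt_iff {n : ℕ} {π : Equiv.Perm (Fin (n + 1))} {i : Fin (n + 1)}
    (hr : ¬ IsRoot π i) (h : π i < i)
    {a : ℕ} : parent π i < a ↔
      ∃ l, 1 ≤ l ∧ l < timeAbove π i ∧ (((π ^ l) i : Fin (n + 1)) : ℕ) + 1 < a := by
  have hp : parent π i = sInf ((fun j : ℕ => (((π ^ j) i : Fin (n + 1)) : ℕ) + 1) ''
      Set.Ico 1 (timeAbove π i)) := by
    exact (if_neg hr).trans (if_neg h.not_gt)
  rw [hp, csInf_lt_iff]
  · constructor
    · rintro ⟨_, ⟨l, hl, rfl⟩, h⟩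
      exact ⟨l, hl.1, hl.2, h⟩
    · rintro ⟨l, h1, h2, h⟩
      exact ⟨_, ⟨l, ⟨h1, h2⟩, rfl⟩, h⟩
  · exact ((Set.finite_Ico _ _).image _).bddBelow
  · exact ⟨_, 1, ⟨le_rfl, one_lt_timeAbove h⟩, rfl⟩

/-- For an excedance `i` the parent is the maximum of the excursion of the orbit above `i`, so it
exceeds the label of `j` exactly when the excursion meets a point above `j`. If `i` is not an
excedance, both sides fail. -/
theorem lt_parent_iff_reach {n : ℕ} {π : Equiv.Perm (Fin (n + 1))} {i j : Fin (n + 1)}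
    (hij : i < j) : (j : ℕ) + 1 < parent π i ↔ Reach π (i < ·) (j < ·) i := by
  by_cases h : i < π i
  · rw [lt_parent_iff h, reach_iff_pow]
    constructor
    · rintro ⟨l, h1, h2, h3⟩
      refine ⟨l, Fin.lt_def.2 (by omega), fun k hk hk' => lt_pow_of_lt_timeBelow hk (by omega)⟩
    · rintro ⟨k, hk, hl⟩
      refine ⟨k, ?_, ?_, by have := Fin.lt_def.1 hk; omega⟩
      · by_contra hc
        obtain rfl : k = 0 := by omega
        exact absurd hij (not_lt.2 (le_of_lt (by simpa using hk)))
      · by_contra hc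
        obtain ⟨h0, h1⟩ := timeBelow_spec π i
        exact absurd (hl _ h0 (not_lt.1 hc)) (not_lt.2 h1)
  · refine iff_of_false (not_lt.2 ?_) fun hR => h (hR.first (not_lt.2 hij.le))
    by_cases hr : IsRoot π i
    · rw [parent_of_isRoot hr]; omega
    · have hlt := lt_of_not_isRoot hr h
      refine le_of_lt ((parent_lt_iff hr hlt).2 ⟨1, le_rfl, one_lt_timeAbove hlt, ?_⟩)
      have := Fin.lt_def.1 hlt
      have := Fin.lt_def.1 hij
      simp only [pow_one]
      omega

/-- Dual to `lt_parent_iff_reach`. The root alternative is separate because the parent of a root is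
`0`, below every label, whatever its orbit does. -/
theorem parent_lt_iff_reach {n : ℕ} {π : Equiv.Perm (Fin (n + 1))} {i j : Fin (n + 1)}
    (hij : i < j) : parent π j < (i : ℕ) + 1 ↔ IsRoot π j ∨ Reach π (· < j) (· < i) j := by
  by_cases hr : IsRoot π j
  · simp [hr, parent_of_isRoot]
  simp only [hr, false_or]
  by_cases h : j < π j
  · refine iff_of_false (not_lt.2 ?_) fun hR => h.not_gt (hR.first (not_lt.2 hij.le))
    refine le_of_lt ((lt_parent_iff h).2 ⟨1, le_rfl, one_lt_timeBelow h, ?_⟩)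
    have := Fin.lt_def.1 h
    have := Fin.lt_def.1 hij
    simp only [pow_one]
    omega
  · have hlt := lt_of_not_isRoot hr h
    rw [parent_lt_iff hr hlt, reach_iff_pow]
    constructor
    · rintro ⟨l, h1, h2, h3⟩
      refine ⟨l, Fin.lt_def.2 (by omega), fun k hk hk' => pow_lt_of_lt_timeAbove hk (by omega)⟩
    · rintro ⟨k, hk, hl⟩
      refine ⟨k, ?_, ?_, by have := Fin.lt_def.1 hk; omega⟩
      · by_contra hc
        obtain rfl : k = 0 := by omega
        exact absurd hij (not_lt.2 (le_of_lt (by simpa using hk)))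
      · by_contra hc
        obtain ⟨h0, h1⟩ := timeAbove_spec π j
        exact absurd (hl _ h0 (not_lt.1 hc)) (not_lt.2 h1)

/-- `(b, a)` is a yin-yang pair. -/
def IsYinYang {n : ℕ} (π : Equiv.Perm (Fin n)) (b a : Fin n) : Prop :=
  b < a ∧ (IsRoot π a ∨ Reach π (· < a) (· < b) a) ∧ Reach π (b < ·) (a < ·) b

theorem IsYinYang.lt_left {n : ℕ} {π : Equiv.Perm (Fin n)} {b a : Fin n}
    (h : IsYinYang π b a) : b < π b := h.2.2.first (not_lt.2 h.1.le)

theorem IsYinYang.le_right {n : ℕ} {π : Equiv.Perm (Fin n)} {b a : Fin n}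
    (h : IsYinYang π b a) : π a ≤ a :=
  h.2.1.elim (fun hr => hr _ ⟨1, by simp⟩) fun hR => (hR.first (not_lt.2 h.1.le)).le

open Classical in
theorem yinYang_eq {n : ℕ} (π : Equiv.Perm (Fin (n + 1))) :
    yinYang π = ((Finset.univ : Finset (Fin n × Fin n)).filter
      fun ij => IsYinYang π ij.1.castSucc ij.2.castSucc).card := by
  unfold yinYang
  congr 1
  ext ⟨i, j⟩
  simp only [Finset.mem_filter, Finset.mem_univ, true_and]
  unfold IsYinYang
  by_cases hij : i < j
  · have hij' : i.castSucc < j.castSucc := hij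
    have h1 := parent_lt_iff_reach (π := π) hij'
    have h2 := lt_parent_iff_reach (π := π) hij'
    simp only [Fin.val_castSucc] at h1 h2
    rw [h1, h2]
    tauto
  · simp [hij]

/-- The orbit of `a` is forced to run through all of `w` before it meets `s`, and `s ∉ a :: w`
prevents it from stopping earlier. -/
theorem reach_eq_iff_of_chain {ι : Type*} {π : Equiv.Perm ι} {A : ι → Prop} {s : ι} :
    ∀ {w : List ι} {a : ι}, s ∉ a :: w → List.IsChain (fun x y => π x = y) (a :: (w ++ [s])) →
      (Reach π A (· = s) a ↔ (∀ x ∈ w, A x) ∧ A s)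
  | [], a, hs, hc => by
    have h : π a = s := by simpa using hc
    constructor
    · intro hR
      exact ⟨by simp, h ▸ hR.first (by simp at hs; exact fun h => hs h.symm)⟩
    · exact fun hA => .step (h.symm ▸ hA.2) (.done h)
  | b :: w, a, hs, hc => by
    rw [List.cons_append, List.isChain_cons_cons] at hc
    have ih := reach_eq_iff_of_chain (A := A) (fun h => hs (List.mem_cons_of_mem _ h)) hc.2
    have hne : a ≠ s := fun h => hs (by simp [h])
    have : Reach π A (· = s) a ↔ A b ∧ Reach π A (· = s) b := by
      rw [← hc.1]
      refine ⟨fun h => ?_, fun h => .step h.1 h.2⟩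
      cases h with
      | done h => exact absurd h hne
      | step h1 h2 => exact ⟨h1, h2⟩
    rw [this, ih]
    simp [and_assoc]

open Classical in
-- A letter is a right-to-left minimum of `w` when its orbit stays above it until `s`; arriving at
-- `s` costs nothing because `s` is maximal.
theorem numRightToLeftMinima_eq {m : ℕ} {π : Equiv.Perm (Fin m)} {s : Fin m}
    (hmax : ∀ a, a ≠ s → a < s) :
    ∀ {w : List (Fin m)}, w.Nodup → s ∉ w → List.IsChain (fun x y => π x = y) (w ++ [s]) →
      numRightToLeftMinima w = (w.toFinset.filter fun a => Reach π (a < ·) (· = s) a).card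
  | [], _, _, _ => by simp [numRightToLeftMinima]
  | a :: w, hn, hs, hc => by
    have ih := numRightToLeftMinima_eq hmax (List.nodup_cons.1 hn).2
      (fun h => hs (List.mem_cons_of_mem _ h)) (List.IsChain.tail hc)
    have ha : Reach π (a < ·) (· = s) a ↔ ∀ x ∈ w, a < x := by
      rw [reach_eq_iff_of_chain hs hc]
      exact and_iff_left (hmax a fun h => hs (by simp [h]))
    have haw : a ∉ w := (List.nodup_cons.1 hn).1
    rw [numRightToLeftMinima, ih, List.toFinset_cons, Finset.filter_insert]
    by_cases h : ∀ x ∈ w, a < x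
    · rw [if_pos h, if_pos (ha.2 h), Finset.card_insert_of_notMem (by simp [haw]), add_comm]
    · rw [if_neg h, if_neg (mt ha.1 h), zero_add]

theorem isChain_toList {n : ℕ} (π : Equiv.Perm (Fin n)) (s : Fin n) (h : π s ≠ s) :
    List.IsChain (fun x y => π x = y) ((π.toList s) ++ [s]) := by
  rw [List.isChain_iff_getElem]
  intro i hi
  simp only [List.length_append, List.length_singleton] at hi
  have key : ∀ k (hk : k < ((π.toList s) ++ [s]).length),
      ((π.toList s) ++ [s])[k] = (π ^ k) s := by
    intro k hk
    rw [List.getElem_append]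
    split_ifs with h1
    · exact Equiv.Perm.getElem_toList _ _ _ _
    · simp only [List.length_append, List.length_singleton] at hk
      -- At the appended entry `k` is the length of the cycle, hence its order, so `π ^ k` brings
      -- `s` back to itself.
      have hk' : k = (π.cycleOf s).support.card := by
        rw [← Equiv.Perm.length_toList]; omega
      rw [List.getElem_singleton, hk', ← (Equiv.Perm.isCycle_cycleOf π h).orderOf,
        ← Equiv.Perm.cycleOf_pow_apply_self, pow_orderOf_eq_one, Equiv.Perm.one_apply]
  rw [key, key, pow_succ', Equiv.Perm.mul_apply]

open Classical in
theorem cPrime_eq {n : ℕ} (π : Equiv.Perm (Fin (n + 1))) :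
    cPrime π = ((Finset.univ : Finset (Fin n)).filter fun i =>
      Reach π (i.castSucc < ·) (· = Fin.last n) i.castSucc).card := by
  have hmax : ∀ a, a ≠ Fin.last n → a < Fin.last n := fun a h => Fin.lt_last_iff_ne_last.2 h
  have hcard : ((Finset.univ : Finset (Fin n)).filter fun i =>
      Reach π (i.castSucc < ·) (· = Fin.last n) i.castSucc).card =
      ((Finset.univ : Finset (Fin (n + 1))).filter fun a =>
        a ≠ Fin.last n ∧ Reach π (a < ·) (· = Fin.last n) a).card := by
    refine Finset.card_bij (fun i _ => i.castSucc) ?_ ?_ ?_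
    · simp +contextual [Fin.castSucc_ne_last]
    · simp
    · intro a ha
      simp only [Finset.mem_filter, Finset.mem_univ, true_and] at ha
      obtain ⟨i, rfl⟩ := Fin.exists_castSucc_eq.2 ha.1
      exact ⟨i, by simpa using ha.2, rfl⟩
  rw [hcard, cPrime, lastCycleWord]
  by_cases hs : π (Fin.last n) = Fin.last n
  · rw [Equiv.Perm.toList_eq_nil_iff.2 (by simpa using hs)]
    simp only [List.tail_nil, numRightToLeftMinima]
    symm
    rw [Finset.card_eq_zero, Finset.filter_eq_empty_iff]
    rintro a - ⟨h1, h2⟩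
    obtain ⟨z, hz, rfl⟩ := h2.sameCycle
    exact h1 (hz.eq_of_right hs)
  · have hc := isChain_toList π _ hs
    have hn := Equiv.Perm.nodup_toList π (Fin.last n)
    have hmem : ∀ a, a ∈ π.toList (Fin.last n) ↔ π.SameCycle (Fin.last n) a := fun a => by
      rw [Equiv.Perm.mem_toList_iff]
      simp [hs]
    obtain ⟨b, w, hw⟩ : ∃ b w, π.toList (Fin.last n) = b :: w := by
      cases hL : π.toList (Fin.last n) with
      | nil => exact absurd (Equiv.Perm.toList_eq_nil_iff.1 hL) (by simpa using hs)
      | cons b w => exact ⟨b, w, rfl⟩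
    have hb : b = Fin.last n := by
      have := Equiv.Perm.toList_getElem_zero (p := π) (x := Fin.last n) (by simpa using hs)
      simpa [hw] using this
    subst hb
    rw [hw] at hc hn hmem ⊢
    rw [List.tail_cons, numRightToLeftMinima_eq hmax (List.nodup_cons.1 hn).2
      (List.nodup_cons.1 hn).1 hc.tail]
    congr 1
    ext a
    simp only [Finset.mem_filter, List.mem_toFinset, Finset.mem_univ, true_and]
    refine and_congr_left fun hR => ?_
    obtain ⟨z, hz, rfl⟩ := hR.sameCycle
    have h1 := (hmem a).2 hz.symm
    rw [List.mem_cons] at h1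
    constructor
    · rintro h rfl
      exact (List.nodup_cons.1 hn).1 h
    · exact fun h => h1.resolve_left h

/-! ### Inserting a point into a permutation -/

/-- On a finite type a cycle is traversed by forward steps alone, so `r` need not be symmetric. -/
theorem rel_of_sameCycle {ι : Type*} [Finite ι] {π : Equiv.Perm ι} {r : ι → ι → Prop}
    (hrefl : ∀ a, r a a) (htrans : ∀ a b c, r a b → r b c → r a c) (h : ∀ a, r a (π a))
    {a b : ι} (hab : π.SameCycle a b) : r a b := by
  obtain ⟨k, rfl⟩ := hab.exists_nat_pow_eq
  induction k with
  | zero => exact hrefl _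
  | succ k ih =>
    rw [pow_succ', Equiv.Perm.mul_apply]
    exact htrans _ _ _ (ih ⟨k, by simp⟩) (h _)

/-- Permutations `π` of `Fin (N + 1)` are pairs of a permutation `σ` of `Fin N` and the image of
`p`; in the cycle notation `p` is inserted right in front of its image, or as a fixed point. -/
def insEquiv {N : ℕ} (p : Fin (N + 1)) :
    Option (Fin N) × Equiv.Perm (Fin N) ≃ Equiv.Perm (Fin (N + 1)) :=
  Equiv.Perm.decomposeOption.symm.trans (finSuccEquiv' p).symm.permCongr

/-- The permutation obtained from `σ` by inserting `p` in front of `o`. -/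
def ins {N : ℕ} (p : Fin (N + 1)) (o : Option (Fin N)) (σ : Equiv.Perm (Fin N)) :
    Equiv.Perm (Fin (N + 1)) := insEquiv p (o, σ)

section Insertion

variable {N : ℕ} {p : Fin (N + 1)} {x u v : Fin N} {σ : Equiv.Perm (Fin N)}

theorem ins_self (o : Option (Fin N)) : ins p o σ p = (finSuccEquiv' p).symm o := by
  simp [ins, insEquiv, Equiv.permCongr_apply]

theorem ins_some_self : ins p (some x) σ p = p.succAbove x := by simp [ins_self]

theorem ins_none_self : ins p none σ p = p := by simp [ins_self]

theorem ins_none_succAbove : ins p none σ (p.succAbove u) = p.succAbove (σ u) := by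
  simp [ins, insEquiv, Equiv.permCongr_apply]

theorem ins_some_succAbove :
    ins p (some x) σ (p.succAbove u) = if σ u = x then p else p.succAbove (σ u) := by
  simp only [ins, insEquiv, Equiv.trans_apply, Equiv.permCongr_apply, Equiv.symm_symm,
    finSuccEquiv'_succAbove, Equiv.Perm.decomposeOption_symm_apply, Equiv.Perm.mul_apply,
    Equiv.optionCongr_apply, Option.map_some]
  split_ifs with h
  · simp [h]
  · rw [Equiv.swap_apply_of_ne_of_ne (by simp) (by simpa using h)]
    simp

theorem ins_some_succAbove_of_ne (h : σ u ≠ x) :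
    ins p (some x) σ (p.succAbove u) = p.succAbove (σ u) := by
  rw [ins_some_succAbove, if_neg h]

theorem ins_some_succAbove_of_eq (h : σ u = x) : ins p (some x) σ (p.succAbove u) = p := by
  rw [ins_some_succAbove, if_pos h]

theorem sameCycle_ins_some_self : (ins p (some x) σ).SameCycle p (p.succAbove x) :=
  ⟨1, by simp [ins_some_self]⟩

/-- Contracting `p` to `x`, which is what `getD x` does, turns every step of the enlarged
permutation into a step of `σ` or into no move at all. -/
theorem sameCycle_getD_of_ins_some {y z : Fin (N + 1)}
    (h : (ins p (some x) σ).SameCycle y z) :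
    σ.SameCycle ((finSuccEquiv' p y).getD x) ((finSuccEquiv' p z).getD x) := by
  refine rel_of_sameCycle
    (r := fun y z => σ.SameCycle ((finSuccEquiv' p y).getD x) ((finSuccEquiv' p z).getD x))
    (fun a => .refl _ _) (fun a b c h h' => h.trans h') (fun a => ?_) h
  rcases Fin.eq_self_or_eq_succAbove p a with rfl | ⟨u, rfl⟩
  · rw [ins_some_self]
    simpa using Equiv.Perm.SameCycle.refl _ _
  · rw [ins_some_succAbove]
    split_ifs with hu
    · simp only [finSuccEquiv'_succAbove, finSuccEquiv'_at, Option.getD_some, Option.getD_none]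
      exact ⟨1, by simp [hu]⟩
    · simpa using Equiv.Perm.SameCycle.refl _ _

theorem sameCycle_ins_some :
    (ins p (some x) σ).SameCycle (p.succAbove u) (p.succAbove v) ↔ σ.SameCycle u v := by
  refine ⟨fun h => by simpa using sameCycle_getD_of_ins_some h, fun h => ?_⟩
  refine rel_of_sameCycle
    (r := fun u v => (ins p (some x) σ).SameCycle (p.succAbove u) (p.succAbove v))
    (fun a => .refl _ _) (fun a b c h h' => h.trans h') (fun a => ?_) h
  by_cases ha : σ a = x
  · have : (ins p (some x) σ).SameCycle (p.succAbove a) p :=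
      ⟨1, by simp [ins_some_succAbove_of_eq ha]⟩
    rw [ha]
    exact this.trans sameCycle_ins_some_self
  · exact ⟨1, by simp [ins_some_succAbove_of_ne ha]⟩

theorem sameCycle_ins_none :
    (ins p none σ).SameCycle (p.succAbove u) (p.succAbove v) ↔ σ.SameCycle u v := by
  constructor
  · intro h
    obtain ⟨k, hk⟩ := h.exists_nat_pow_eq
    have : ∀ k : ℕ, (ins p none σ ^ k) (p.succAbove u) = p.succAbove ((σ ^ k) u) := by
      intro k
      induction k with
      | zero => simp
      | succ k ih =>
        rw [pow_succ', pow_succ', Equiv.Perm.mul_apply, Equiv.Perm.mul_apply, ih,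
          ins_none_succAbove]
    rw [this] at hk
    exact ⟨k, by simpa using hk⟩
  · intro h
    exact rel_of_sameCycle
      (r := fun u v => (ins p none σ).SameCycle (p.succAbove u) (p.succAbove v))
      (fun a => .refl _ _) (fun a b c h h' => h.trans h')
      (fun a => ⟨1, by simp [ins_none_succAbove]⟩) h

/-- The orbit makes one detour, through `p` just before `x`. `h1` says that the detour is allowed
whenever `x` is, and `h2` that a path ending at `p` may as well end at `x`. -/
theorem reach_ins_some {A B : Fin (N + 1) → Prop} {A' B' : Fin N → Prop}
    (hA : ∀ u, A (p.succAbove u) ↔ A' u) (hB : ∀ u, B (p.succAbove u) ↔ B' u)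
    (h1 : A (p.succAbove x) → A p) (h2 : B p → B (p.succAbove x) ∧ A (p.succAbove x)) :
    Reach (ins p (some x) σ) A B (p.succAbove u) ↔ Reach σ A' B' u := by
  constructor
  -- Paths may pass through `p`, so the induction carries a claim for the start `p` too: it amounts
  -- to entering `x`.
  · suffices H : ∀ y, Reach (ins p (some x) σ) A B y →
        (∀ u, y = p.succAbove u → Reach σ A' B' u) ∧ (y = p → A' x ∧ Reach σ A' B' x) from
      fun h => (H _ h).1 _ rfl
    intro y h
    induction h with
    | done h =>
      constructor
      · rintro u rfl
        exact .done ((hB u).1 h)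
      · rintro rfl
        exact ⟨(hA x).1 (h2 h).2, .done ((hB x).1 (h2 h).1)⟩
    | @step y hy _ ih =>
      constructor
      · rintro u rfl
        by_cases hu : σ u = x
        · obtain ⟨ih1, ih2⟩ := ih.2 (ins_some_succAbove_of_eq hu)
          exact .step (hu.symm ▸ ih1) (hu.symm ▸ ih2)
        · rw [ins_some_succAbove_of_ne hu] at hy ih
          exact .step ((hA _).1 hy) (ih.1 _ rfl)
      · rintro rfl
        rw [ins_some_self] at hy ih
        exact ⟨(hA x).1 hy, ih.1 _ rfl⟩
  · intro h
    induction h with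
    | done h => exact .done ((hB _).2 h)
    | @step u hu _ ih =>
      by_cases hux : σ u = x
      · rw [hux] at hu ih
        have hx := (hA x).2 hu
        have e := ins_some_succAbove_of_eq (p := p) hux
        refine .step (e.symm ▸ h1 hx) (e.symm ▸ .step ?_ ?_)
        · rwa [ins_some_self]
        · rwa [ins_some_self]
      · have e := ins_some_succAbove_of_ne (p := p) hux
        exact .step (e.symm ▸ (hA _).2 hu) (e.symm ▸ ih)

theorem reach_ins_none {A B : Fin (N + 1) → Prop} {A' B' : Fin N → Prop}
    (hA : ∀ u, A (p.succAbove u) ↔ A' u) (hB : ∀ u, B (p.succAbove u) ↔ B' u) :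
    Reach (ins p none σ) A B (p.succAbove u) ↔ Reach σ A' B' u := by
  constructor
  · generalize hy : p.succAbove u = y
    intro h
    induction h generalizing u with
    | done h => exact .done ((hB u).1 (hy ▸ h))
    | step h _ ih =>
      subst hy
      rw [ins_none_succAbove] at h ih
      exact .step ((hA _).1 h) (ih rfl)
  · intro h
    induction h with
    | done h => exact .done ((hB _).2 h)
    | step h _ ih =>
      exact .step (by rw [ins_none_succAbove]; exact (hA _).2 h)
        (by rw [ins_none_succAbove]; exact ih)

theorem val_succAbove (p : Fin (N + 1)) (u : Fin N) :
    (p.succAbove u : ℕ) = if (u : ℕ) < p then (u : ℕ) else u + 1 := by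
  simp only [Fin.succAbove, Fin.lt_def, Fin.val_castSucc]
  split_ifs <;> simp

/-- Only `p` joins an old cycle, that of `x`; the hypothesis keeps it from overtaking the root
there. -/
theorem isRoot_ins_some_iff (h : IsRoot σ u → x ≤ u → p ≤ p.succAbove u) :
    IsRoot (ins p (some x) σ) (p.succAbove u) ↔ IsRoot σ u := by
  constructor
  · intro hr v hv
    exact p.succAbove_le_succAbove_iff.1 (hr _ (sameCycle_ins_some.2 hv))
  · intro hr y hy
    rcases Fin.eq_self_or_eq_succAbove p y with rfl | ⟨v, rfl⟩
    · exact h hr (hr _ (sameCycle_ins_some.1 (hy.trans sameCycle_ins_some_self)))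
    · exact p.succAbove_le_succAbove_iff.2 (hr _ (sameCycle_ins_some.1 hy))

theorem numCycles_ins_some {n : ℕ} {p : Fin (n + 2)} {x : Fin (n + 1)}
    {σ : Equiv.Perm (Fin (n + 1))} : numCycles (ins p (some x) σ) = numCycles σ := by
  unfold numCycles
  symm
  refine Nat.card_eq_of_bijective (Quotient.map (sa := Equiv.Perm.SameCycle.setoid σ)
    (sb := Equiv.Perm.SameCycle.setoid (ins p (some x) σ)) p.succAbove
    fun a b h => sameCycle_ins_some.2 h) ⟨?_, ?_⟩
  · rintro ⟨a⟩ ⟨b⟩ h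
    exact Quotient.sound (sameCycle_ins_some.1 (Quotient.exact h))
  · rintro ⟨y⟩
    rcases Fin.eq_self_or_eq_succAbove p y with rfl | ⟨v, rfl⟩
    · exact ⟨⟦x⟧, Quotient.sound sameCycle_ins_some_self.symm⟩
    · exact ⟨⟦v⟧, rfl⟩

theorem numCycles_ins_none {n : ℕ} {p : Fin (n + 2)}
    {σ : Equiv.Perm (Fin (n + 1))} : numCycles (ins p none σ) = numCycles σ + 1 := by
  unfold numCycles
  rw [← Finite.card_option]
  symm
  refine Nat.card_eq_of_bijective (fun o => o.elim
    (Quotient.mk (Equiv.Perm.SameCycle.setoid (ins p none σ)) p)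
    (Quotient.map (sa := Equiv.Perm.SameCycle.setoid σ)
      (sb := Equiv.Perm.SameCycle.setoid (ins p none σ)) p.succAbove
      fun a b h => sameCycle_ins_none.2 h)) ⟨?_, ?_⟩
  · have key : ∀ u, ¬ (ins p none σ).SameCycle p (p.succAbove u) := fun u h =>
      absurd (h.eq_of_left ins_none_self) (p.succAbove_ne u).symm
    rintro (_ | ⟨⟨a⟩⟩) (_ | ⟨⟨b⟩⟩) h
    · rfl
    · exact absurd (Quotient.exact h) (key b)
    · exact absurd (Quotient.exact h).symm (key a)
    · exact congrArg some (Quotient.sound (sameCycle_ins_none.1 (Quotient.exact h)))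
  · rintro ⟨y⟩
    rcases Fin.eq_self_or_eq_succAbove p y with rfl | ⟨v, rfl⟩
    · exact ⟨none, rfl⟩
    · exact ⟨some ⟦v⟧, rfl⟩

end Insertion

/-- `π` and `σ` have the same yin-yang pairs, up to the inclusion `p.succAbove`, and none of them
involves `p`. -/
theorem yinYang_eq_of_succAbove {n : ℕ} {π : Equiv.Perm (Fin (n + 2))}
    {σ : Equiv.Perm (Fin (n + 1))} (p : Fin (n + 1))
    (h : ∀ b a, IsYinYang π (p.castSucc.succAbove b) (p.castSucc.succAbove a) ↔ IsYinYang σ b a)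
    (h1 : ∀ a, ¬ IsYinYang π p.castSucc a) (h2 : ∀ b, ¬ IsYinYang π b p.castSucc) :
    yinYang π = yinYang σ := by
  classical
  rw [yinYang_eq, yinYang_eq]
  symm
  refine Finset.card_bij (fun ij _ => (p.succAbove ij.1, p.succAbove ij.2)) ?_ ?_ ?_
  · rintro ⟨b, a⟩ hb
    simp only [Finset.mem_filter, Finset.mem_univ, true_and] at hb ⊢
    rwa [← Fin.castSucc_succAbove_castSucc, ← Fin.castSucc_succAbove_castSucc, h]
  · rintro ⟨b, a⟩ - ⟨b', a'⟩ - he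
    simpa using he
  · rintro ⟨b, a⟩ hb
    simp only [Finset.mem_filter, Finset.mem_univ, true_and] at hb
    rcases Fin.eq_self_or_eq_succAbove p b with rfl | ⟨b, rfl⟩
    · exact absurd hb (h1 _)
    rcases Fin.eq_self_or_eq_succAbove p a with rfl | ⟨a, rfl⟩
    · exact absurd hb (h2 _)
    refine ⟨(b, a), ?_, rfl⟩
    simp only [Finset.mem_filter, Finset.mem_univ, true_and]
    rwa [← Fin.castSucc_succAbove_castSucc, ← Fin.castSucc_succAbove_castSucc, h] at hb

open Classical in
theorem cPrime_eq_of_succAbove {n : ℕ} {π : Equiv.Perm (Fin (n + 2))}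
    {σ : Equiv.Perm (Fin (n + 1))} (p : Fin (n + 1))
    (h : ∀ b, Reach π (p.castSucc.succAbove b < ·) (· = Fin.last _) (p.castSucc.succAbove b) ↔
      Reach σ (b < ·) (· = Fin.last _) b) :
    cPrime π = cPrime σ +
      if Reach π (p.castSucc < ·) (· = Fin.last _) p.castSucc then 1 else 0 := by
  rw [cPrime_eq, cPrime_eq, Finset.card_filter, Finset.card_filter, Fin.sum_univ_succAbove _ p,
    add_comm]
  congr 1
  refine Finset.sum_congr rfl fun b _ => ?_
  rw [← Fin.castSucc_succAbove_castSucc, h]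

theorem isYinYang_congr {N M : ℕ} {π : Equiv.Perm (Fin N)} {σ : Equiv.Perm (Fin M)}
    {b a : Fin N} {b' a' : Fin M} (hlt : b < a ↔ b' < a')
    (hroot : b' < a' → (IsRoot π a ↔ IsRoot σ a'))
    (hdown : b' < a' → (Reach π (· < a) (· < b) a ↔ Reach σ (· < a') (· < b') a'))
    (hup : b' < a' → (Reach π (b < ·) (a < ·) b ↔ Reach σ (b' < ·) (a' < ·) b')) :
    IsYinYang π b a ↔ IsYinYang σ b' a' := by
  unfold IsYinYang
  by_cases h : b' < a'
  · rw [hlt, hroot h, hdown h, hup h]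
  · simp [hlt, h]

/-! Inserting `i.castSucc` in front of `i.succ`, which is not an excedance. -/

section InsertCastSucc

variable {N : ℕ} {i : Fin N} {σ : Equiv.Perm (Fin N)}

theorem ins_castSucc_succ_le (hi : σ i ≤ i) :
    ins i.castSucc (some i) σ i.succ ≤ i.castSucc := by
  rw [← Fin.succAbove_castSucc_self]
  by_cases h : σ i = i
  · rw [ins_some_succAbove_of_eq h]
  · rw [ins_some_succAbove_of_ne h]
    have := Fin.lt_def.1 (lt_of_le_of_ne hi h)
    rw [Fin.le_def, val_succAbove]
    simp only [Fin.val_castSucc]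
    split_ifs; omega

theorem exc_ins_castSucc (u : Fin N) :
    i.castSucc.succAbove u < ins i.castSucc (some i) σ (i.castSucc.succAbove u) ↔ u < σ u := by
  by_cases h : σ u = i
  · rw [ins_some_succAbove_of_eq h, h, Fin.lt_def, Fin.lt_def, val_succAbove]
    simp only [Fin.val_castSucc]
    split_ifs <;> omega
  · rw [ins_some_succAbove_of_ne h, Fin.succAbove_lt_succAbove_iff]

/-- From `i.castSucc` the orbit goes to `i.succ` and then at once to a point not above `i.castSucc`.
-/
theorem not_reach_ins_castSucc (hi : σ i ≤ i) {B : Fin (N + 1) → Prop}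
    (hB : ¬ B i.castSucc) (hB' : ¬ B i.succ) :
    ¬ Reach (ins i.castSucc (some i) σ) (i.castSucc < ·) B i.castSucc := by
  intro h
  cases h with
  | done h => exact hB h
  | step _ h =>
    rw [ins_some_self, Fin.succAbove_castSucc_self] at h
    exact (ins_castSucc_succ_le hi).not_gt (h.first hB')

/-- The inserted label and its successor on the orbit are consecutive integers, so only a threshold
at `i` can tell them apart. The case `b = i` is void because `i` is not an excedance; `a = i` does
no harm. -/
theorem isYinYang_ins_castSucc (hi : σ i ≤ i) (b a : Fin N) :
    IsYinYang (ins i.castSucc (some i) σ) (i.castSucc.succAbove b) (i.castSucc.succAbove a) ↔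
      IsYinYang σ b a := by
  by_cases hb : b = i
  · subst hb
    refine iff_of_false (fun h => ?_) fun h => h.lt_left.not_ge hi
    exact h.lt_left.not_ge (not_lt.1 (mt (exc_ins_castSucc b).1 hi.not_gt))
  have hb' : (b : ℕ) ≠ i := fun h => hb (Fin.ext h)
  refine isYinYang_congr Fin.succAbove_lt_succAbove_iff (fun _ => ?_) (fun hba => ?_)
    (fun hba => ?_)
  · refine isRoot_ins_some_iff fun _ hx => ?_
    rw [Fin.le_def] at hx ⊢
    rw [val_succAbove]
    simp only [Fin.val_castSucc]
    split_ifs <;> omega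
  · refine reach_ins_some (fun u => Fin.succAbove_lt_succAbove_iff)
      (fun u => Fin.succAbove_lt_succAbove_iff) ?_ ?_ <;>
    · rw [Fin.lt_def] at hba
      simp only [Fin.lt_def, val_succAbove, Fin.val_castSucc]
      split_ifs <;> omega
  · refine reach_ins_some (fun u => Fin.succAbove_lt_succAbove_iff)
      (fun u => Fin.succAbove_lt_succAbove_iff) ?_ ?_ <;>
    · rw [Fin.lt_def] at hba
      simp only [Fin.lt_def, val_succAbove, Fin.val_castSucc]
      split_ifs <;> omega

theorem not_isYinYang_ins_castSucc_left (hi : σ i ≤ i) (a : Fin (N + 1)) :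
    ¬ IsYinYang (ins i.castSucc (some i) σ) i.castSucc a := by
  rintro ⟨h, -, hR⟩
  refine not_reach_ins_castSucc hi h.not_gt ?_ hR
  rw [Fin.lt_def] at h ⊢
  simp only [Fin.val_castSucc, Fin.val_succ] at h ⊢
  omega

theorem not_isYinYang_ins_castSucc_right (b : Fin (N + 1)) :
    ¬ IsYinYang (ins i.castSucc (some i) σ) b i.castSucc := fun h => by
  have := h.le_right
  rw [ins_some_self, Fin.succAbove_castSucc_self] at this
  exact this.not_gt Fin.castSucc_lt_succ

theorem yinYang_ins_castSucc {n : ℕ} {i : Fin (n + 1)} {σ : Equiv.Perm (Fin (n + 1))}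
    (hi : σ i ≤ i) : yinYang (ins i.castSucc (some i) σ) = yinYang σ :=
  yinYang_eq_of_succAbove i (isYinYang_ins_castSucc hi) (not_isYinYang_ins_castSucc_left hi)
    not_isYinYang_ins_castSucc_right

theorem succAbove_castSucc_eq_last_iff {n : ℕ} {p u : Fin (n + 1)} :
    p.castSucc.succAbove u = Fin.last (n + 1) ↔ u = Fin.last n := by
  rw [Fin.ext_iff, Fin.ext_iff, val_succAbove]
  simp only [Fin.val_castSucc, Fin.val_last]
  split_ifs <;> omega

/-- The new letter is followed by `i.succ` and then by something not larger than itself, so it is no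
right-to-left minimum, unless `i.succ` is the largest element and the word ends there. -/
theorem cPrime_ins_castSucc {n : ℕ} {i : Fin (n + 1)} {σ : Equiv.Perm (Fin (n + 1))}
    (hi : σ i ≤ i) :
    cPrime (ins i.castSucc (some i) σ) = cPrime σ + if i = Fin.last n then 1 else 0 := by
  classical
  rw [cPrime_eq_of_succAbove (σ := σ) i]
  · congr 1
    refine if_congr ?_ rfl rfl
    constructor
    · intro h
      by_contra hc
      refine not_reach_ins_castSucc hi (Fin.castSucc_ne_last _) ?_ h
      rwa [← Fin.succ_last, Fin.succ_inj]
    · rintro rfl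
      refine .step ?_ (.done ?_) <;> rw [ins_some_self, Fin.succAbove_castSucc_self]
      · exact Fin.castSucc_lt_succ
      · rfl
  · intro b
    refine reach_ins_some (fun u => Fin.succAbove_lt_succAbove_iff)
      (fun u => succAbove_castSucc_eq_last_iff) ?_ fun h => absurd h (Fin.castSucc_ne_last _)
    simp only [Fin.lt_def, val_succAbove, Fin.val_castSucc]
    split_ifs <;> omega

end InsertCastSucc

/-! Inserting `i.succ` in front of `i.castSucc`, which is an excedance. -/

section InsertSucc

variable {N : ℕ} {i : Fin N} {σ : Equiv.Perm (Fin N)}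

theorem exc_ins_succ (hi : i < σ i) (u : Fin N) :
    i.succ.succAbove u < ins i.succ (some i) σ (i.succ.succAbove u) ↔ u < σ u := by
  by_cases h : σ u = i
  · have hu : (u : ℕ) ≠ i := fun he => by
      rw [Fin.ext he] at h
      exact hi.ne' h
    rw [ins_some_succAbove_of_eq h, h, Fin.lt_def, Fin.lt_def, val_succAbove]
    simp only [Fin.val_succ]
    split_ifs <;> omega
  · rw [ins_some_succAbove_of_ne h, Fin.succAbove_lt_succAbove_iff]

theorem succ_lt_ins_succ (hi : i < σ i) :
    i.succ < ins i.succ (some i) σ i.castSucc := by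
  rw [← Fin.succAbove_succ_self, ins_some_succAbove_of_ne hi.ne']
  rw [Fin.lt_def] at hi ⊢
  rw [val_succAbove]
  simp only [Fin.val_succ]
  split_ifs <;> omega

theorem ins_succ_self : ins i.succ (some i) σ i.succ = i.castSucc := by
  rw [ins_some_self, Fin.succAbove_succ_self]

/-- Again consecutive labels are neighbours on the orbit. This time the threshold `a = i` is the
dangerous one, and it is void because `i` is an excedance. -/
theorem isYinYang_ins_succ (hi : i < σ i) (b a : Fin N) :
    IsYinYang (ins i.succ (some i) σ) (i.succ.succAbove b) (i.succ.succAbove a) ↔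
      IsYinYang σ b a := by
  by_cases ha : a = i
  · subst ha
    refine iff_of_false (fun h => ?_) fun h => h.le_right.not_gt hi
    exact h.le_right.not_gt ((exc_ins_succ hi a).2 hi)
  have ha' : (a : ℕ) ≠ i := fun h => ha (Fin.ext h)
  refine isYinYang_congr Fin.succAbove_lt_succAbove_iff (fun _ => ?_) (fun hba => ?_)
    (fun hba => ?_)
  · refine isRoot_ins_some_iff fun _ hx => ?_
    rw [Fin.le_def] at hx ⊢
    rw [val_succAbove]
    simp only [Fin.val_succ]
    split_ifs <;> omega
  · refine reach_ins_some (fun u => Fin.succAbove_lt_succAbove_iff)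
      (fun u => Fin.succAbove_lt_succAbove_iff) ?_ ?_ <;>
    · rw [Fin.lt_def] at hba
      simp only [Fin.lt_def, val_succAbove, Fin.val_succ]
      split_ifs <;> omega
  · refine reach_ins_some (fun u => Fin.succAbove_lt_succAbove_iff)
      (fun u => Fin.succAbove_lt_succAbove_iff) ?_ ?_ <;>
    · rw [Fin.lt_def] at hba
      simp only [Fin.lt_def, val_succAbove, Fin.val_succ]
      split_ifs <;> omega

theorem not_isYinYang_ins_succ_left (a : Fin (N + 1)) :
    ¬ IsYinYang (ins i.succ (some i) σ) i.succ a := fun h => by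
  have := h.lt_left
  rw [ins_succ_self] at this
  exact this.not_gt Fin.castSucc_lt_succ

/-- The orbit of `i.succ` visits `i.castSucc`, which is not below `b`, and then jumps above
`i.succ`. This rules out both being a root and reaching a point below `b` in time. -/
theorem not_isYinYang_ins_succ_right (hi : i < σ i) (b : Fin (N + 1)) :
    ¬ IsYinYang (ins i.succ (some i) σ) b i.succ := by
  rintro ⟨hb, hr | hR, -⟩
  · refine (hr (ins i.succ (some i) σ i.castSucc) ⟨2, ?_⟩).not_gt (succ_lt_ins_succ hi)
    rw [zpow_two, Equiv.Perm.mul_apply, ins_succ_self]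
  · cases hR with
    | done h => exact h.not_gt hb
    | step _ h =>
      rw [ins_succ_self] at h
      refine (h.first ?_).not_gt (succ_lt_ins_succ hi)
      rw [Fin.lt_def] at hb ⊢
      simp only [Fin.val_castSucc, Fin.val_succ] at hb ⊢
      omega

theorem yinYang_ins_succ {n : ℕ} {i : Fin n} {σ : Equiv.Perm (Fin (n + 1))}
    (hi : i.castSucc < σ i.castSucc) :
    yinYang (ins i.castSucc.succ (some i.castSucc) σ) = yinYang σ :=
  yinYang_eq_of_succAbove i.succ (isYinYang_ins_succ hi) not_isYinYang_ins_succ_left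
    (not_isYinYang_ins_succ_right hi)

theorem cPrime_ins_succ {n : ℕ} {i : Fin n} {σ : Equiv.Perm (Fin (n + 1))} :
    cPrime (ins i.castSucc.succ (some i.castSucc) σ) = cPrime σ := by
  classical
  rw [cPrime_eq_of_succAbove (σ := σ) i.succ, if_neg, add_zero]
  · intro h
    have := h.first (Fin.castSucc_ne_last _)
    rw [← Fin.succ_castSucc, ins_succ_self] at this
    exact this.not_gt Fin.castSucc_lt_succ
  · intro b
    refine reach_ins_some (fun u => Fin.succAbove_lt_succAbove_iff)
      (fun u => ?_) ?_ fun h => absurd h (Fin.castSucc_ne_last i.succ)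
    · rw [Fin.succ_castSucc, succAbove_castSucc_eq_last_iff]
    simp only [Fin.lt_def, val_succAbove, Fin.val_castSucc, Fin.val_succ]
    split_ifs <;> omega

end InsertSucc

/-! Inserting `0` as a fixed point. -/

section InsertZero

variable {n : ℕ} {σ : Equiv.Perm (Fin (n + 1))}

theorem yinYang_ins_zero : yinYang (ins (0 : Fin (n + 1)).castSucc none σ) = yinYang σ := by
  refine yinYang_eq_of_succAbove 0 (fun b a => ?_) (fun a h => ?_) fun b h => ?_
  · refine isYinYang_congr Fin.succAbove_lt_succAbove_iff (fun _ => ?_) (fun _ => ?_) fun _ => ?_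
    · constructor
      · intro hr v hv
        exact Fin.succAbove_le_succAbove_iff.1 (hr _ (sameCycle_ins_none.2 hv))
      · intro hr y hy
        rcases Fin.eq_self_or_eq_succAbove (0 : Fin (n + 1)).castSucc y with rfl | ⟨v, rfl⟩
        · exact Fin.zero_le _
        · exact Fin.succAbove_le_succAbove_iff.2 (hr _ (sameCycle_ins_none.1 hy))
    · exact reach_ins_none (fun _ => Fin.succAbove_lt_succAbove_iff)
        fun _ => Fin.succAbove_lt_succAbove_iff
    · exact reach_ins_none (fun _ => Fin.succAbove_lt_succAbove_iff)
        fun _ => Fin.succAbove_lt_succAbove_iff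
  · have := h.lt_left
    rw [ins_none_self] at this
    exact this.false
  · exact absurd h.1 (Fin.zero_le _).not_gt

theorem cPrime_ins_zero : cPrime (ins (0 : Fin (n + 1)).castSucc none σ) = cPrime σ := by
  classical
  rw [cPrime_eq_of_succAbove (σ := σ) 0, if_neg, add_zero]
  · intro h
    have := h.first (Fin.castSucc_ne_last _)
    rw [ins_none_self] at this
    exact this.false
  · exact fun b => reach_ins_none (fun _ => Fin.succAbove_lt_succAbove_iff)
      fun _ => succAbove_castSucc_eq_last_iff

end InsertZero

/-! ### Conjugation by an adjacent transposition -/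

theorem reach_congr {ι : Type*} {π : Equiv.Perm ι} {A A' B B' : ι → Prop} {y : ι}
    (hA : ∀ z, A' z ↔ A z) (hB : ∀ z, B' z ↔ B z) : Reach π A B y ↔ Reach π A' B' y := by
  rw [funext fun z => propext (hA z), funext fun z => propext (hB z)]

/-- No successful path visits `d`, since such a path would succeed from `d` on; forbidding `d` loses
nothing. -/
theorem reach_shrink {ι : Type*} {π : Equiv.Perm ι} {A A' B B' : ι → Prop} {d y : ι}
    (hA : ∀ z, A' z ↔ A z ∧ z ≠ d) (hB : ∀ z, B' z ↔ B z) (hd : ¬ Reach π A B d) :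
    Reach π A B y ↔ Reach π A' B' y := by
  constructor <;> intro h
  · induction h with
    | done h => exact .done ((hB _).2 h)
    | @step y h h' ih => exact .step ((hA _).2 ⟨h, fun he => hd (he ▸ h')⟩) ih
  · induction h with
    | done h => exact .done ((hB _).1 h)
    | step h _ ih => exact .step ((hA _).1 h).1 ih

/-- Stopping at `d` gains nothing: either the path can be continued from `d` into `B`, or `d` is a
fixed point, which an orbit starting elsewhere never meets. -/
theorem reach_grow {ι : Type*} {π : Equiv.Perm ι} {A A' B B' : ι → Prop} {d y : ι}
    (hA : ∀ z, A' z ↔ A z) (hB : ∀ z, B' z ↔ B z ∨ z = d)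
    (hd : Reach π A B d ∨ π d = d ∧ y ≠ d) :
    Reach π A B y ↔ Reach π A' B' y := by
  constructor <;> intro h
  · clear hd
    induction h with
    | done h => exact .done ((hB _).2 (.inl h))
    | step h _ ih => exact .step ((hA _).2 h) ih
  · induction h with
    | done h =>
      rcases (hB _).1 h with h | rfl
      · exact .done h
      · exact hd.resolve_right fun h => h.2 rfl
    | @step y h _ ih =>
      refine .step ((hA _).1 h) (ih (hd.imp_right fun hd => ⟨hd.1, fun he => hd.2 ?_⟩))
      exact π.injective (he.trans hd.1.symm)

theorem reach_conj {ι : Type*} {π e : Equiv.Perm ι} {A B : ι → Prop} {y : ι} :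
    Reach (e * π * e⁻¹) A B (e y) ↔ Reach π (fun z => A (e z)) (fun z => B (e z)) y := by
  have key : ∀ z, (e * π * e⁻¹) (e z) = e (π z) := fun z => by simp
  constructor
  · generalize hx : e y = x
    intro h
    induction h generalizing y with
    | done h => exact .done (hx.symm ▸ h)
    | step h _ ih =>
      subst hx
      rw [key] at h ih
      exact .step h (ih rfl)
  · intro h
    induction h with
    | done h => exact .done h
    | step h _ ih => exact .step ((key _).symm ▸ h) ((key _).symm ▸ ih)

section Conj

variable {N : ℕ} {P Q : Fin N} {π : Equiv.Perm (Fin N)}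

theorem val_swap (h : (Q : ℕ) = P + 1) (z : Fin N) : (Equiv.swap P Q z : ℕ) =
    if (z : ℕ) = P then (P : ℕ) + 1 else if (z : ℕ) = P + 1 then (P : ℕ) else z := by
  rw [Equiv.swap_apply_def]
  simp only [Fin.ext_iff, h, apply_ite Fin.val]

theorem not_reach_right (h : (Q : ℕ) = P + 1) (hQ : π Q ≤ Q) {B : Fin N → Prop}
    (hB : ¬ B Q) : ¬ Reach π (P < ·) B Q := by
  by_cases hf : π Q = Q
  · generalize hy : Q = y
    intro hR
    induction hR with
    | done hd => exact hB (hy ▸ hd)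
    | step _ _ ih => exact ih (by rw [← hy, hf])
  · intro hR
    have h1 := Fin.lt_def.1 (hR.first hB)
    have h2 := Fin.le_def.1 hQ
    exact hf (Fin.ext (by omega))

theorem not_reach_left (hP : Q < π P) {B : Fin N → Prop}
    (hB : ¬ B P) : ¬ Reach π (· < Q) B P := fun hR => (hR.first hB).not_gt hP

/-- Exchanging consecutive labels alters only the comparison of `P` with `Q`, and the hypotheses
exclude a step of `π` between these two. -/
theorem exc_conj (h : (Q : ℕ) = P + 1) (hP : Q < π P) (hQ : π Q ≤ Q) (hQP : π Q ≠ P) (z : Fin N) :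
    Equiv.swap P Q z < (Equiv.swap P Q * π * (Equiv.swap P Q)⁻¹) (Equiv.swap P Q z) ↔
      z < π z := by
  simp only [Equiv.Perm.mul_apply, Equiv.swap_inv, Equiv.swap_apply_self, Fin.lt_def, val_swap h]
  rw [Fin.lt_def] at hP
  rw [Fin.le_def] at hQ
  have hQP' : (π Q : ℕ) ≠ P := fun he => hQP (Fin.ext he)
  by_cases h1 : z = P
  · subst h1
    simp
    split_ifs <;> omega
  by_cases h2 : z = Q
  · subst h2
    simp only [h]
    split_ifs <;> omega
  have h1' : (z : ℕ) ≠ P := fun he => h1 (Fin.ext he)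
  have h2' : (z : ℕ) ≠ P + 1 := fun he => h2 (Fin.ext (by omega))
  split_ifs <;> omega

theorem isRoot_conj {e : Equiv.Perm (Fin N)} {a : Fin N} :
    IsRoot (e * π * e⁻¹) (e a) ↔ ∀ j, π.SameCycle a j → e j ≤ e a := by
  unfold IsRoot
  rw [← e.forall_congr_right]
  simp [Equiv.Perm.sameCycle_conj]

/-- Relabelling changes a threshold set only when `a = Q` or `b = P`, and then by a single point.
That point is harmless by `reach_shrink` or `reach_grow`, because `P` jumps above `Q` at once while
`Q` is fixed or jumps below `P`. -/
theorem isYinYang_conj (h : (Q : ℕ) = P + 1) (hP : Q < π P) (hQ : π Q ≤ Q) (hQP : π Q ≠ P)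
    {b a : Fin N} (hne : b = P → a ≠ Q) :
    IsYinYang (Equiv.swap P Q * π * (Equiv.swap P Q)⁻¹) (Equiv.swap P Q b) (Equiv.swap P Q a) ↔
      IsYinYang π b a := by
  have hPQ : P < Q := Fin.lt_def.2 (by omega)
  by_cases ha : a = P
  · subst ha
    refine iff_of_false (fun h' => ?_) fun h' => h'.le_right.not_gt (hPQ.trans hP)
    exact h'.le_right.not_gt ((exc_conj h hP hQ hQP a).2 (hPQ.trans hP))
  by_cases hb : b = Q
  · subst hb
    refine iff_of_false (fun h' => ?_) fun h' => hQ.not_gt h'.lt_left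
    exact hQ.not_gt ((exc_conj h hP hQ hQP b).1 h'.lt_left)
  have ha' : (a : ℕ) ≠ P := fun h' => ha (Fin.ext h')
  have hb' : (b : ℕ) ≠ P + 1 := fun h' => hb (Fin.ext (by omega))
  have hne' : (b : ℕ) = P → (a : ℕ) ≠ P + 1 := fun h1 h2 =>
    hne (Fin.ext h1) (Fin.ext (by omega))
  refine isYinYang_congr ?_ (fun hba => ?_) (fun hba => ?_) (fun hba => ?_)
  · simp only [Fin.lt_def, val_swap h]
    split_ifs <;> omega
  · rw [isRoot_conj]
    constructor
    · intro hr j hj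
      have := hr j hj
      simp only [Fin.le_def, val_swap h] at this ⊢
      split_ifs at this <;> omega
    · intro hr j hj
      have hle := Fin.le_def.1 (hr j hj)
      -- If `P` lay in the cycle of the root `Q`, so would `π P`, which exceeds `Q`.
      have hjP : (a : ℕ) = P + 1 → (j : ℕ) ≠ P := fun h1 h2 => by
        obtain rfl : j = P := Fin.ext h2
        have := Fin.le_def.1 (hr (π j) (Equiv.Perm.sameCycle_apply_right.2 hj))
        have := Fin.lt_def.1 hP
        omega
      simp only [Fin.le_def, val_swap h]
      split_ifs <;> omega
  · rw [reach_conj]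
    rw [Fin.lt_def] at hba
    symm
    by_cases haQ : (a : ℕ) = P + 1
    · refine reach_shrink (d := P) (fun z => ?_) (fun z => ?_) ?_
      · simp only [Fin.lt_def, val_swap h, ne_eq, Fin.ext_iff]
        split_ifs <;> omega
      · simp only [Fin.lt_def, val_swap h]
        split_ifs <;> omega
      · obtain rfl : a = Q := Fin.ext (by omega)
        refine not_reach_left hP ?_
        rw [Fin.lt_def]
        omega
    by_cases hbP : (b : ℕ) = P
    · refine reach_grow (d := Q) (fun z => ?_) (fun z => ?_) ?_
      · simp only [Fin.lt_def, val_swap h]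
        split_ifs <;> omega
      · simp only [Fin.lt_def, val_swap h, Fin.ext_iff]
        split_ifs <;> omega
      · by_cases hf : π Q = Q
        · exact .inr ⟨hf, fun h' => haQ (by rw [h', h])⟩
        · have h1 := Fin.lt_def.1 (lt_of_le_of_ne hQ hf)
          have h2 : (π Q : ℕ) ≠ P := fun he => hQP (Fin.ext he)
          exact .inl (.step (Fin.lt_def.2 (by omega)) (.done (Fin.lt_def.2 (by omega))))
    refine reach_congr (fun z => ?_) (fun z => ?_) <;>
    · simp only [Fin.lt_def, val_swap h]
      split_ifs <;> omega
  · rw [reach_conj]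
    rw [Fin.lt_def] at hba
    symm
    by_cases hbP : (b : ℕ) = P
    · refine reach_shrink (d := Q) (fun z => ?_) (fun z => ?_) ?_
      · simp only [Fin.lt_def, val_swap h, ne_eq, Fin.ext_iff]
        split_ifs <;> omega
      · simp only [Fin.lt_def, val_swap h]
        split_ifs <;> omega
      · obtain rfl : b = P := Fin.ext hbP
        refine not_reach_right h hQ ?_
        rw [Fin.lt_def]
        omega
    by_cases haQ : (a : ℕ) = P + 1
    · refine reach_grow (d := P) (fun z => ?_) (fun z => ?_) (.inl ?_)
      · simp only [Fin.lt_def, val_swap h]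
        split_ifs <;> omega
      · simp only [Fin.lt_def, val_swap h, Fin.ext_iff]
        split_ifs <;> omega
      · rw [Fin.lt_def] at hP
        exact .step (Fin.lt_def.2 (by omega)) (.done (Fin.lt_def.2 (by omega)))
    refine reach_congr (fun z => ?_) (fun z => ?_) <;>
    · simp only [Fin.lt_def, val_swap h]
      split_ifs <;> omega

/-- This is the pair lost under conjugation: its image `(Q, P)` is in the wrong order. -/
theorem isYinYang_of_desc (h : (Q : ℕ) = P + 1) (hP : Q < π P) (hQ : π Q ≤ Q) (hQP : π Q ≠ P) :
    IsYinYang π P Q := by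
  have hPQ : P < Q := Fin.lt_def.2 (by omega)
  refine ⟨hPQ, ?_, .step (hPQ.trans hP) (.done hP)⟩
  by_cases hf : π Q = Q
  · exact .inl fun j hj => (hj.eq_of_left hf).ge
  · have hlt := lt_of_le_of_ne hQ hf
    have h1 := Fin.lt_def.1 hlt
    have h2 : (π Q : ℕ) ≠ P := fun he => hQP (Fin.ext he)
    exact .inr (.step hlt (.done (Fin.lt_def.2 (by omega))))

end Conj

theorem numCycles_conj {n : ℕ} (π e : Equiv.Perm (Fin (n + 1))) :
    numCycles (e * π * e⁻¹) = numCycles π := by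
  unfold numCycles
  symm
  refine Nat.card_congr (Quotient.congr (ra := Equiv.Perm.SameCycle.setoid π)
    (rb := Equiv.Perm.SameCycle.setoid (e * π * e⁻¹)) e fun a b => ?_)
  change π.SameCycle a b ↔ (e * π * e⁻¹).SameCycle (e a) (e b)
  simp [Equiv.Perm.sameCycle_conj]

section ConjSite

variable {n : ℕ} {P Q : Fin n} {π : Equiv.Perm (Fin (n + 1))}

theorem castSucc_swap (z : Fin n) :
    (Equiv.swap P Q z).castSucc = Equiv.swap P.castSucc Q.castSucc z.castSucc :=
  (Fin.castSucc_injective n).map_swap P Q z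

theorem yinYang_conj (h : (Q : ℕ) = P + 1) (hP : Q.castSucc < π P.castSucc)
    (hQ : π Q.castSucc ≤ Q.castSucc) (hQP : π Q.castSucc ≠ P.castSucc) :
    yinYang π = yinYang (Equiv.swap P.castSucc Q.castSucc * π *
      (Equiv.swap P.castSucc Q.castSucc)⁻¹) + 1 := by
  classical
  rw [yinYang_eq, yinYang_eq, Finset.card_filter, Finset.card_filter]
  have h1 : (1 : ℕ) = ∑ ij : Fin n × Fin n, if ij = (P, Q) then 1 else 0 := by simp
  refine Eq.trans ?_ (congrArg₂ (· + ·)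
    (((Equiv.swap P Q).prodCongr (Equiv.swap P Q)).sum_comp _) h1.symm)
  rw [← Finset.sum_add_distrib]
  refine Finset.sum_congr rfl fun ij _ => ?_
  obtain ⟨b, a⟩ := ij
  simp only [Equiv.prodCongr_apply, Prod.map_apply, castSucc_swap]
  by_cases hne : b = P ∧ a = Q
  · obtain ⟨rfl, rfl⟩ := hne
    rw [if_pos (isYinYang_of_desc (P := b.castSucc) (Q := a.castSucc) h hP hQ hQP), if_neg, if_pos rfl]
    intro hy
    have := Fin.lt_def.1 hy.1
    rw [Equiv.swap_apply_left, Equiv.swap_apply_right] at this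
    simp only [Fin.val_castSucc] at this
    omega
  · have hne' : b.castSucc = P.castSucc → a.castSucc ≠ Q.castSucc := fun h1 h2 =>
      hne ⟨Fin.castSucc_injective _ h1, Fin.castSucc_injective _ h2⟩
    have hneg : ¬ (b, a) = (P, Q) := fun he => hne (Prod.mk.inj he)
    rw [if_neg hneg, add_zero]
    exact if_congr (isYinYang_conj (P := P.castSucc) (Q := Q.castSucc) h hP hQ hQP hne').symm
      rfl rfl

/-- Only the test at `P` could notice the exchange, through a visit to `Q`; but from `Q` the orbit
stays at `Q` or falls below `P`, so no successful path goes there. -/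
theorem cPrime_conj (h : (Q : ℕ) = P + 1) (hP : Q.castSucc < π P.castSucc)
    (hQ : π Q.castSucc ≤ Q.castSucc) (hQP : π Q.castSucc ≠ P.castSucc) :
    cPrime (Equiv.swap P.castSucc Q.castSucc * π *
      (Equiv.swap P.castSucc Q.castSucc)⁻¹) = cPrime π := by
  classical
  rw [cPrime_eq, cPrime_eq, Finset.card_filter, Finset.card_filter]
  refine ((Equiv.sum_comp (Equiv.swap P Q) _).symm).trans ?_
  refine Finset.sum_congr rfl fun b _ => if_congr ?_ rfl rfl
  have h' : (Q.castSucc : ℕ) = P.castSucc + 1 := h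
  have hPn := P.isLt
  have hQn := Q.isLt
  rw [castSucc_swap]
  by_cases hb : b = Q
  · subst hb
    refine iff_of_false (fun hR => ?_) fun hR => hQ.not_gt (hR.first (Fin.castSucc_ne_last _))
    refine hQ.not_gt ((exc_conj h' hP hQ hQP _).1 (hR.first ?_))
    rw [← castSucc_swap]
    exact Fin.castSucc_ne_last _
  have hb' : (b : ℕ) ≠ P + 1 := fun he => hb (Fin.ext (by omega))
  rw [reach_conj]
  symm
  by_cases hbP : b = P
  · subst hbP
    refine reach_shrink (d := Q.castSucc) (fun z => ?_) (fun z => ?_)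
      (not_reach_right h' hQ (Fin.castSucc_ne_last _))
    · simp only [Fin.lt_def, val_swap h', ne_eq, Fin.ext_iff, Fin.val_castSucc]
      split_ifs <;> omega
    · simp only [val_swap h', Fin.ext_iff, Fin.val_castSucc, Fin.val_last]
      split_ifs <;> omega
  · have hbP' : (b : ℕ) ≠ P := fun he => hbP (Fin.ext he)
    refine reach_congr (fun z => ?_) (fun z => ?_)
    · simp only [Fin.lt_def, val_swap h', Fin.val_castSucc]
      split_ifs <;> omega
    · simp only [val_swap h', Fin.ext_iff, Fin.val_castSucc, Fin.val_last]
      split_ifs <;> omega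

end ConjSite

/-! ### Recursions for the weights -/

/-- The indicator of the excedance set. -/
def excConfig {n : ℕ} (π : Equiv.Perm (Fin (n + 1))) : Config n :=
  fun i => decide (i.castSucc < π i.castSucc)

/-- The weight of a permutation. -/
def permWeight {n : ℕ} (α β q : ℝ) (π : Equiv.Perm (Fin (n + 1))) : ℝ :=
  α⁻¹ ^ numCycles π * β⁻¹ ^ cPrime π * q ^ yinYang π

/-- The total weight of the permutations with a given excedance set. -/
def configWeight {n : ℕ} (α β q : ℝ) (η : Config n) : ℝ :=
  ∑ π : Equiv.Perm (Fin (n + 1)), if excConfig π = η then permWeight α β q π else 0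

theorem sum_ins_some {N : ℕ} (p : Fin (N + 1)) (x : Fin N) (f : Equiv.Perm (Fin (N + 1)) → ℝ) :
    (∑ π, if π p = p.succAbove x then f π else 0) = ∑ σ, f (ins p (some x) σ) := by
  rw [← (insEquiv p).sum_comp, Fintype.sum_prod_type, Finset.sum_eq_single (some x)]
  · refine Finset.sum_congr rfl fun σ _ => ?_
    exact if_pos ins_some_self
  · intro o _ ho
    refine Finset.sum_eq_zero fun σ _ => if_neg fun h => ho ?_
    change ins p o σ p = _ at h
    rw [ins_self, Equiv.symm_apply_eq, finSuccEquiv'_succAbove] at h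
    exact h
  · simp

theorem sum_ins_none {N : ℕ} (p : Fin (N + 1)) (f : Equiv.Perm (Fin (N + 1)) → ℝ) :
    (∑ π, if π p = p then f π else 0) = ∑ σ, f (ins p none σ) := by
  rw [← (insEquiv p).sum_comp, Fintype.sum_prod_type, Finset.sum_eq_single none]
  · refine Finset.sum_congr rfl fun σ _ => ?_
    exact if_pos ins_none_self
  · intro o _ ho
    refine Finset.sum_eq_zero fun σ _ => if_neg fun h => ho ?_
    change ins p o σ p = _ at h
    rw [ins_self, Equiv.symm_apply_eq, finSuccEquiv'_at] at h
    exact h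
  · simp

theorem excConfig_eq_iff_of_succAbove {n : ℕ} {π : Equiv.Perm (Fin (n + 2))}
    {σ : Equiv.Perm (Fin (n + 1))} {p : Fin (n + 1)} {η : Config (n + 1)}
    (h : ∀ u, p.castSucc.succAbove u < π (p.castSucc.succAbove u) ↔ u < σ u) :
    excConfig π = η ↔
      decide (p.castSucc < π p.castSucc) = η p ∧ excConfig σ = η ∘ p.succAbove := by
  rw [funext_iff, funext_iff, Fin.forall_iff_succAbove p]
  refine and_congr Iff.rfl (forall_congr' fun i => ?_)
  simp only [excConfig, Function.comp_apply]
  rw [← Fin.castSucc_succAbove_castSucc, decide_eq_decide.2 (h _)]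

section Relations

variable {n : ℕ} {α β q : ℝ}

/-- A non-excedance at the smallest element is a fixed point; deleting it removes one cycle and
nothing else. -/
theorem configWeight_zero_left (hα : 0 < α) {η : Config (n + 1)} (h : η 0 = false) :
    α * configWeight α β q η = configWeight α β q (η ∘ (0 : Fin (n + 1)).succAbove) := by
  have hfix : ∀ π : Equiv.Perm (Fin (n + 2)), excConfig π = η →
      π (Fin.castSucc 0) = Fin.castSucc 0 := fun π hπ => by
    have h0 := congrFun hπ 0
    rw [h, excConfig, decide_eq_false_iff_not, not_lt] at h0
    exact le_antisymm h0 (Fin.zero_le _)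
  have e : configWeight α β q η = ∑ π : Equiv.Perm (Fin (n + 2)),
      if π (Fin.castSucc 0) = Fin.castSucc 0 then
        (if excConfig π = η then permWeight α β q π else 0) else 0 := by
    refine Finset.sum_congr rfl fun π _ => ?_
    by_cases hπ : excConfig π = η
    · rw [if_pos (hfix π hπ)]
    · simp [hπ]
  rw [e, sum_ins_none, configWeight, Finset.mul_sum]
  refine Finset.sum_congr rfl fun σ _ => ?_
  rw [mul_ite, mul_zero]
  refine ite_congr (propext ?_) (fun _ => ?_) fun _ => rfl
  · rw [excConfig_eq_iff_of_succAbove (σ := σ), ins_none_self, h]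
    · simp
    · intro u
      rw [ins_none_succAbove, Fin.succAbove_lt_succAbove_iff]
  · rw [permWeight, numCycles_ins_none, cPrime_ins_zero, yinYang_ins_zero, permWeight, pow_succ]
    field_simp

/-- An excedance at the last site must map to the largest element; deleting it shortens the word by
its final letter, always a right-to-left minimum. -/
theorem configWeight_last_true (hβ : 0 < β) {η : Config (n + 1)} (h : η (Fin.last n) = true) :
    β * configWeight α β q η = configWeight α β q (η ∘ (Fin.last n).succAbove) := by
  have hfix : ∀ π : Equiv.Perm (Fin (n + 2)), excConfig π = η →
      π (Fin.last n).castSucc = (Fin.last n).castSucc.succAbove (Fin.last n) := fun π hπ => by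
    have h0 := congrFun hπ (Fin.last n)
    rw [h, excConfig, decide_eq_true_iff] at h0
    rw [Fin.succAbove_castSucc_self, Fin.succ_last]
    rw [Fin.lt_def] at h0
    simp only [Fin.val_castSucc, Fin.val_last] at h0
    refine Fin.ext ?_
    have := (π (Fin.last n).castSucc).isLt
    rw [Fin.val_last]
    omega
  have e : configWeight α β q η = ∑ π : Equiv.Perm (Fin (n + 2)),
      if π (Fin.last n).castSucc = (Fin.last n).castSucc.succAbove (Fin.last n) then
        (if excConfig π = η then permWeight α β q π else 0) else 0 := by
    refine Finset.sum_congr rfl fun π _ => ?_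
    by_cases hπ : excConfig π = η
    · rw [if_pos (hfix π hπ)]
    · simp [hπ]
  rw [e, sum_ins_some, configWeight, Finset.mul_sum]
  refine Finset.sum_congr rfl fun σ _ => ?_
  rw [mul_ite, mul_zero]
  refine ite_congr (propext ?_) (fun _ => ?_) fun _ => rfl
  · rw [excConfig_eq_iff_of_succAbove exc_ins_castSucc, ins_some_self,
      Fin.succAbove_castSucc_self, h]
    simp
  · have hi : σ (Fin.last n) ≤ Fin.last n := Fin.le_last _
    rw [permWeight, numCycles_ins_some, cPrime_ins_castSucc hi, yinYang_ins_castSucc hi, permWeight,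
      if_pos rfl, pow_succ]
    field_simp

section Bulk

variable {i : Fin n} {η : Config (n + 1)}

theorem sum_exc_to_succ (h0 : η i.castSucc = true) (h1 : η i.succ = false) :
    (∑ π : Equiv.Perm (Fin (n + 2)), if π i.castSucc.castSucc = i.succ.castSucc then
      (if excConfig π = η then permWeight α β q π else 0) else 0) =
    configWeight α β q (η ∘ i.castSucc.succAbove) := by
  have hQ : i.succ.castSucc = i.castSucc.castSucc.succAbove i.castSucc := by
    rw [Fin.succAbove_castSucc_self, Fin.succ_castSucc]
  rw [hQ, sum_ins_some, configWeight]
  refine Finset.sum_congr rfl fun σ _ => ite_congr (propext ?_) (fun hσ => ?_) fun _ => rfl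
  · rw [excConfig_eq_iff_of_succAbove exc_ins_castSucc, ins_some_self, Fin.succAbove_castSucc_self,
      h0]
    simp
  · have hi : σ i.castSucc ≤ i.castSucc := by
      have := congrFun hσ i
      rw [Function.comp_apply, Fin.succAbove_castSucc_self, h1, excConfig,
        decide_eq_false_iff_not, not_lt] at this
      exact this
    rw [permWeight, numCycles_ins_some, cPrime_ins_castSucc hi, yinYang_ins_castSucc hi, permWeight,
      if_neg (Fin.castSucc_ne_last _), add_zero]

theorem sum_succ_to_exc (h0 : η i.castSucc = true) (h1 : η i.succ = false) :
    (∑ π : Equiv.Perm (Fin (n + 2)), if π i.succ.castSucc = i.castSucc.castSucc then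
      (if π i.castSucc.castSucc ≠ i.succ.castSucc ∧ excConfig π = η then
        permWeight α β q π else 0) else 0) =
    configWeight α β q (η ∘ i.succ.succAbove) := by
  have hP : i.castSucc.castSucc = i.succ.castSucc.succAbove i.castSucc := by
    rw [← Fin.succ_castSucc, Fin.succAbove_succ_self]
  rw [hP, sum_ins_some, configWeight]
  have key : ∀ σ : Equiv.Perm (Fin (n + 1)), excConfig σ = η ∘ i.succ.succAbove →
      i.castSucc < σ i.castSucc := fun σ hσ => by
    have := congrFun hσ i
    rwa [Function.comp_apply, Fin.succAbove_succ_self, h0, excConfig,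
      decide_eq_true_iff] at this
  have exc : ∀ σ : Equiv.Perm (Fin (n + 1)), i.castSucc < σ i.castSucc →
      (excConfig (ins i.succ.castSucc (some i.castSucc) σ) = η ↔
        excConfig σ = η ∘ i.succ.succAbove) := fun σ hσ => by
    rw [excConfig_eq_iff_of_succAbove (σ := σ), ins_some_self, ← hP, h1]
    · simp only [and_iff_right_iff_imp, decide_eq_false_iff_not, not_lt]
      exact fun _ => (Fin.castSucc_lt_castSucc_iff.2 Fin.castSucc_lt_succ).le
    · rw [← Fin.succ_castSucc]
      exact exc_ins_succ hσ
  refine Finset.sum_congr rfl fun σ _ => ite_congr (propext ?_) (fun hσ => ?_) fun _ => rfl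
  · constructor
    · rintro ⟨hne, hσ⟩
      refine (exc σ ?_).1 hσ
      -- The condition `π P ≠ Q` enters here: contracting `Q` would otherwise turn the excedance `P`
      -- into a fixed point.
      have hne' : σ i.castSucc ≠ i.castSucc := fun h => hne (ins_some_succAbove_of_eq h)
      have h := congrFun hσ i.castSucc
      rwa [h0, excConfig, decide_eq_true_iff, hP, ins_some_succAbove_of_ne hne',
        Fin.succAbove_lt_succAbove_iff] at h
    · intro hσ
      have hi := key σ hσ
      refine ⟨?_, (exc σ hi).2 hσ⟩
      rw [ins_some_succAbove_of_ne hi.ne']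
      exact Fin.succAbove_ne _ _
  · have hi := key σ hσ
    rw [← Fin.succ_castSucc, permWeight, numCycles_ins_some, cPrime_ins_succ, yinYang_ins_succ hi,
      permWeight]

theorem sum_swap (h0 : η i.castSucc = true) (h1 : η i.succ = false) :
    (∑ π : Equiv.Perm (Fin (n + 2)), if π i.castSucc.castSucc ≠ i.succ.castSucc ∧
        π i.succ.castSucc ≠ i.castSucc.castSucc ∧ excConfig π = η then
      permWeight α β q π else 0) =
    q * configWeight α β q (η ∘ Equiv.swap i.castSucc i.succ) := by
  rw [configWeight, Finset.mul_sum]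
  refine Eq.trans ?_ ((MulAut.conj
    (Equiv.swap i.castSucc.castSucc i.succ.castSucc)).toEquiv.sum_comp _)
  refine Finset.sum_congr rfl fun π _ => ?_
  rw [mul_ite, mul_zero]
  have hv : ((i.succ : Fin (n + 1)) : ℕ) = (i.castSucc : Fin (n + 1)) + 1 := rfl
  have hv' : ((i.succ.castSucc : Fin (n + 2)) : ℕ) = (i.castSucc.castSucc : Fin (n + 2)) + 1 := rfl
  change _ = if excConfig (Equiv.swap i.castSucc.castSucc i.succ.castSucc * π *
    (Equiv.swap i.castSucc.castSucc i.succ.castSucc)⁻¹) = _ then q * permWeight α β q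
      (Equiv.swap i.castSucc.castSucc i.succ.castSucc * π *
    (Equiv.swap i.castSucc.castSucc i.succ.castSucc)⁻¹) else 0
  set π' := Equiv.swap i.castSucc.castSucc i.succ.castSucc * π *
    (Equiv.swap i.castSucc.castSucc i.succ.castSucc)⁻¹ with hπ'
  have exc : i.succ.castSucc < π i.castSucc.castSucc → π i.succ.castSucc ≤ i.succ.castSucc →
      π i.succ.castSucc ≠ i.castSucc.castSucc →
      (excConfig π' = η ∘ Equiv.swap i.castSucc i.succ ↔ excConfig π = η) := by
    intro hP hQ hQP
    rw [funext_iff, funext_iff, ← (Equiv.swap i.castSucc i.succ).forall_congr_right]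
    refine forall_congr' fun k => ?_
    rw [Function.comp_apply, Equiv.swap_apply_self, excConfig, excConfig, castSucc_swap]
    rw [decide_eq_decide.2 (exc_conj hv' hP hQ hQP k.castSucc)]
  have hiff : (π i.castSucc.castSucc ≠ i.succ.castSucc ∧
      π i.succ.castSucc ≠ i.castSucc.castSucc ∧ excConfig π = η) ↔
      excConfig π' = η ∘ Equiv.swap i.castSucc i.succ := by
    constructor
    · rintro ⟨hPQ, hQP, hπ⟩
      refine (exc ?_ ?_ hQP).2 hπ
      · have h := congrFun hπ i.castSucc
        rw [h0, excConfig, decide_eq_true_iff] at h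
        refine lt_of_le_of_ne ?_ hPQ.symm
        rw [Fin.lt_def] at h
        rw [Fin.le_def]
        omega
      · have h := congrFun hπ i.succ
        rwa [h1, excConfig, decide_eq_false_iff_not, not_lt] at h
    · intro hπ
      -- The excedance pattern of the conjugate at the two sites already forces the conditions on
      -- `π`, so conjugation matches the remaining permutations with all those having the exchanged
      -- pattern.
      have e1 := congrFun hπ i.castSucc
      have e2 := congrFun hπ i.succ
      rw [Function.comp_apply, Equiv.swap_apply_left, h1, excConfig, decide_eq_false_iff_not,
        not_lt, hπ', Equiv.Perm.mul_apply, Equiv.Perm.mul_apply, Equiv.swap_inv,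
        Equiv.swap_apply_left, Fin.le_def, val_swap hv'] at e1
      rw [Function.comp_apply, Equiv.swap_apply_right, h0, excConfig, decide_eq_true_iff,
        hπ', Equiv.Perm.mul_apply, Equiv.Perm.mul_apply, Equiv.swap_inv,
        Equiv.swap_apply_right, Fin.lt_def, val_swap hv'] at e2
      have hP : i.succ.castSucc < π i.castSucc.castSucc := by
        rw [Fin.lt_def]
        split_ifs at e2 <;> omega
      have hQ : π i.succ.castSucc ≤ i.succ.castSucc := by
        rw [Fin.le_def]
        split_ifs at e1 <;> omega
      have hQP : π i.succ.castSucc ≠ i.castSucc.castSucc := by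
        rw [Ne, Fin.ext_iff]
        split_ifs at e1 <;> omega
      exact ⟨hP.ne', hQP, (exc hP hQ hQP).1 hπ⟩
  refine ite_congr (propext hiff) (fun h => ?_) fun _ => rfl
  · obtain ⟨hPQ, hQP, hπ⟩ := hiff.2 h
    have hP : i.succ.castSucc < π i.castSucc.castSucc := by
      have h := congrFun hπ i.castSucc
      rw [h0, excConfig, decide_eq_true_iff] at h
      refine lt_of_le_of_ne ?_ hPQ.symm
      rw [Fin.lt_def] at h
      rw [Fin.le_def]
      omega
    have hQ : π i.succ.castSucc ≤ i.succ.castSucc := by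
      have h := congrFun hπ i.succ
      rwa [h1, excConfig, decide_eq_false_iff_not, not_lt] at h
    rw [permWeight, permWeight, hπ', numCycles_conj, cPrime_conj hv hP hQ hQP,
      yinYang_conj hv hP hQ hQP, pow_succ]
    ring

theorem configWeight_true_false (h0 : η i.castSucc = true) (h1 : η i.succ = false) :
    configWeight α β q η = q * configWeight α β q (η ∘ Equiv.swap i.castSucc i.succ) +
      configWeight α β q (η ∘ i.castSucc.succAbove) +
      configWeight α β q (η ∘ i.succ.succAbove) := by
  rw [← sum_swap h0 h1, ← sum_exc_to_succ h0 h1, ← sum_succ_to_exc h0 h1, configWeight,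
    ← Finset.sum_add_distrib, ← Finset.sum_add_distrib]
  refine Finset.sum_congr rfl fun π _ => ?_
  generalize i.succ.castSucc = Q
  generalize i.castSucc.castSucc = P
  by_cases hA : π P = Q <;> by_cases hB : π Q = P <;> simp [hA, hB]

end Bulk

end Relations

/-! ### The balance equations -/

section Balance

variable {n : ℕ} {Q : Fin n → Fin n → ℝ} {b d : Fin n → ℝ}

theorem vecMul_generator (w : Config n → ℝ) (η : Config n) :
    Matrix.vecMul w (generator Q b d) η = ∑ η', w η' * transitionRate Q b d η' η -
      w η * ∑ η', transitionRate Q b d η η' := by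
  rw [generator, Matrix.vecMul_sub, Pi.sub_apply, Matrix.vecMul_diagonal]
  rfl

theorem sum_transitionRate (η : Config n) : ∑ η', transitionRate Q b d η η' =
    (∑ i, ∑ j, if η i = true ∧ η j = false then Q i j else 0) +
      (∑ i, if η i = false then b i else 0) + ∑ i, if η i = true then d i else 0 := by
  have key : ∀ (p : Prop) [Decidable p] (ζ : Config n) (r : ℝ),
      (∑ η' : Config n, if p ∧ η' = ζ then r else 0) = if p then r else 0 := fun p _ ζ r => by
    by_cases hp : p <;> simp [hp]
  simp only [transitionRate, Finset.sum_add_distrib]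
  congr 1
  · congr 1
    · rw [Finset.sum_comm]
      refine Finset.sum_congr rfl fun i _ => ?_
      rw [Finset.sum_comm]
      refine Finset.sum_congr rfl fun j _ => ?_
      simp only [← and_assoc]
      exact key _ _ _
    · rw [Finset.sum_comm]
      exact Finset.sum_congr rfl fun i _ => key _ _ _
  · rw [Finset.sum_comm]
    exact Finset.sum_congr rfl fun i _ => key _ _ _

/-- Each event has a unique predecessor of `η`: swaps are involutions, and a birth or death is
undone by resetting the site. -/
theorem sum_mul_transitionRate (w : Config n → ℝ) (η : Config n) :
    ∑ η', w η' * transitionRate Q b d η' η =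
    (∑ i, ∑ j, if η j = true ∧ η i = false then Q i j * w (η ∘ Equiv.swap i j) else 0) +
      (∑ i, if η i = true then b i * w (Function.update η i false) else 0) +
      ∑ i, if η i = false then d i * w (Function.update η i true) else 0 := by
  have key : ∀ (p : Config n → Prop) [DecidablePred p] (ζ : Config n) (t : Prop) [Decidable t]
      (r : ℝ), (∀ η', p η' ↔ t ∧ η' = ζ) →
      (∑ η' : Config n, w η' * if p η' then r else 0) = if t then r * w ζ else 0 := by
    intro p _ ζ t _ r h
    simp only [h]
    by_cases ht : t <;> simp [ht, mul_comm]
  simp only [transitionRate, mul_add, Finset.sum_add_distrib, Finset.mul_sum]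
  congr 1
  · congr 1
    · rw [Finset.sum_comm]
      refine Finset.sum_congr rfl fun i _ => ?_
      rw [Finset.sum_comm]
      refine Finset.sum_congr rfl fun j _ => key _ _ _ _ fun η' => ?_
      constructor
      · rintro ⟨h1, h2, rfl⟩
        refine ⟨by simp [h1, h2], ?_⟩
        ext k
        simp
      · rintro ⟨⟨h1, h2⟩, rfl⟩
        refine ⟨by simp [h1], by simp [h2], ?_⟩
        ext k
        simp
    · rw [Finset.sum_comm]
      refine Finset.sum_congr rfl fun i _ => key _ _ _ _ fun η' => ?_
      constructor
      · rintro ⟨h1, rfl⟩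
        simp [← h1]
      · rintro ⟨h1, rfl⟩
        simp [← h1]
  · rw [Finset.sum_comm]
    refine Finset.sum_congr rfl fun i _ => key _ _ _ _ fun η' => ?_
    constructor
    · rintro ⟨h1, rfl⟩
      simp [← h1]
    · rintro ⟨h1, rfl⟩
      simp [← h1]

end Balance

theorem sum_asepJump_mul {n : ℕ} (q : ℝ) (F : Fin (n + 1) → Fin (n + 1) → ℝ) :
    ∑ i, ∑ j, asepJump (n + 1) q i j * F i j =
      ∑ k : Fin n, (F k.castSucc k.succ + q * F k.succ k.castSucc) := by
  have h1 : ∀ G : Fin (n + 1) → Fin (n + 1) → ℝ,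
      (∑ i : Fin (n + 1), ∑ j : Fin (n + 1), if (j : ℕ) = (i : ℕ) + 1 then G i j else 0) =
        ∑ k : Fin n, G k.castSucc k.succ := fun G => by
    rw [Fin.sum_univ_castSucc]
    have : (∑ j : Fin (n + 1), if (j : ℕ) = (Fin.last n : ℕ) + 1 then G (Fin.last n) j else 0) = 0 :=
      Finset.sum_eq_zero fun j _ => if_neg (by have := j.isLt; rw [Fin.val_last]; omega)
    rw [this, add_zero]
    refine Finset.sum_congr rfl fun k _ => ?_
    rw [Finset.sum_eq_single k.succ]
    · simp
    · exact fun j _ hj => if_neg fun h => hj (Fin.ext (by simpa using h))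
    · simp
  have h2 : ∀ i j : Fin (n + 1), asepJump (n + 1) q i j * F i j =
      (if (j : ℕ) = (i : ℕ) + 1 then F i j else 0) +
        if (i : ℕ) = (j : ℕ) + 1 then q * F i j else 0 := fun i j => by
    unfold asepJump
    split_ifs with h h' <;> first | omega | simp
  simp only [h2, Finset.sum_add_distrib]
  rw [h1, Finset.sum_comm (f := fun i j : Fin (n + 1) =>
    if (i : ℕ) = (j : ℕ) + 1 then q * F i j else 0), h1 fun i j => q * F j i]

theorem asepBirth_zero {n : ℕ} (α : ℝ) (i : Fin (n + 1)) :
    asepBirth (n + 1) α 0 i = if i = 0 then α else 0 := by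
  simp only [asepBirth, ite_self, add_zero, Fin.ext_iff, Fin.val_zero]

theorem asepDeath_zero {n : ℕ} (β : ℝ) (i : Fin (n + 1)) :
    asepDeath (n + 1) β 0 i = if i = Fin.last n then β else 0 := by
  simp only [asepDeath, ite_self, zero_add, Fin.ext_iff, Fin.val_last, Nat.add_right_cancel_iff]

/-! ### Stationarity and positivity of the weights -/

section Stationary

variable {n : ℕ} {α β q : ℝ}

/-- The net flow into `η` across a bond is a difference of weights on one site less. -/
theorem configWeight_bond (η : Config (n + 1)) (k : Fin n) :
    ((if η k.succ = true ∧ η k.castSucc = false then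
        configWeight α β q (η ∘ Equiv.swap k.castSucc k.succ) else 0) -
      if η k.castSucc = true ∧ η k.succ = false then configWeight α β q η else 0) +
    q * ((if η k.castSucc = true ∧ η k.succ = false then
        configWeight α β q (η ∘ Equiv.swap k.succ k.castSucc) else 0) -
      if η k.succ = true ∧ η k.castSucc = false then configWeight α β q η else 0) =
    (if η k.castSucc = true then -1 else 1) *
        configWeight α β q (η ∘ k.castSucc.succAbove) -
      (if η k.succ = true then -1 else 1) * configWeight α β q (η ∘ k.succ.succAbove) := by
  have hsw : ∀ j : Fin n, k.castSucc.succAbove j ≠ k.succ.succAbove j →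
      k.castSucc.succAbove j = k.succ ∧ k.succ.succAbove j = k.castSucc := by
    intro j hj
    have hjk : j = k := by
      by_contra hc
      have hc' : (j : ℕ) ≠ k := fun h => hc (Fin.ext h)
      refine hj (Fin.ext ?_)
      rw [val_succAbove, val_succAbove]
      simp only [Fin.val_castSucc, Fin.val_succ]
      split_ifs <;> omega
    subst hjk
    exact ⟨Fin.succAbove_castSucc_self _, Fin.succAbove_succ_self _⟩
  have hcomp : ∀ j : Fin n, Equiv.swap k.castSucc k.succ (k.castSucc.succAbove j) =
      k.succ.succAbove j := by
    intro j
    by_cases hj : k.castSucc.succAbove j = k.succ.succAbove j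
    · rw [Equiv.swap_apply_of_ne_of_ne (Fin.succAbove_ne _ _), hj]
      rw [hj]
      exact Fin.succAbove_ne _ _
    · rw [(hsw j hj).1, (hsw j hj).2, Equiv.swap_apply_right]
  rw [Equiv.swap_comm k.succ k.castSucc]
  cases h0 : η k.castSucc <;> cases h1 : η k.succ
  -- With equal occupation at both ends nothing crosses the bond, and deleting either end gives the
  -- same configuration.
  · have : η ∘ k.castSucc.succAbove = η ∘ k.succ.succAbove := by
      ext j
      by_cases hj : k.castSucc.succAbove j = k.succ.succAbove j
      · simp [hj]
      · simp [(hsw j hj).1, (hsw j hj).2, h0, h1]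
    simp [this]
  -- For a hole followed by a particle the recursion is applied to the exchanged configuration,
  -- which interchanges the two deletions.
  · have e := configWeight_true_false (α := α) (β := β) (q := q) (i := k)
      (η := η ∘ Equiv.swap k.castSucc k.succ) (by simp [h1]) (by simp [h0])
    have e1 : (η ∘ Equiv.swap k.castSucc k.succ) ∘ Equiv.swap k.castSucc k.succ = η := by
      ext j
      simp
    have e2 : (η ∘ Equiv.swap k.castSucc k.succ) ∘ k.castSucc.succAbove =
        η ∘ k.succ.succAbove := by
      ext j
      simp only [Function.comp_apply, hcomp]
    have e3 : (η ∘ Equiv.swap k.castSucc k.succ) ∘ k.succ.succAbove =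
        η ∘ k.castSucc.succAbove := by
      ext j
      simp only [Function.comp_apply, ← hcomp, Equiv.swap_apply_self]
    rw [e1, e2, e3] at e
    simp only [and_self, if_true, e]
    simp
    ring
  · have e := configWeight_true_false (α := α) (β := β) (q := q) (i := k) (η := η) h0 h1
    simp
    linarith
  · have : η ∘ k.castSucc.succAbove = η ∘ k.succ.succAbove := by
      ext j
      by_cases hj : k.castSucc.succAbove j = k.succ.succAbove j
      · simp [hj]
      · simp [(hsw j hj).1, (hsw j hj).2, h0, h1]
    simp [this]

theorem update_comp_succAbove (η : Config (n + 1)) (p : Fin (n + 1)) (a : Bool) :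
    Function.update η p a ∘ p.succAbove = η ∘ p.succAbove := by
  ext j
  simp

theorem configWeight_left (hα : 0 < α) (η : Config (n + 1)) :
    (if η 0 = true then α * configWeight α β q (Function.update η 0 false) else 0) -
      (if η 0 = false then α * configWeight α β q η else 0) =
    -((if η 0 = true then -1 else 1) *
      configWeight α β q (η ∘ (0 : Fin (n + 1)).succAbove)) := by
  cases h : η 0
  · simp [configWeight_zero_left hα h]
  · have := configWeight_zero_left (β := β) (q := q) hα
      (η := Function.update η 0 false) (by simp)
    rw [update_comp_succAbove] at this
    simp [this]

theorem configWeight_right (hβ : 0 < β) (η : Config (n + 1)) :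
    (if η (Fin.last n) = false then
        β * configWeight α β q (Function.update η (Fin.last n) true) else 0) -
      (if η (Fin.last n) = true then β * configWeight α β q η else 0) =
    (if η (Fin.last n) = true then -1 else 1) *
      configWeight α β q (η ∘ (Fin.last n).succAbove) := by
  cases h : η (Fin.last n)
  · have := configWeight_last_true (α := α) (q := q) hβ
      (η := Function.update η (Fin.last n) true) (by simp)
    rw [update_comp_succAbove] at this
    simp [this]
  · simp [configWeight_last_true hβ h]

/-- The bond terms telescope to a difference between the two ends; birth at the first site and death
at the last cancel them. -/
theorem vecMul_configWeight (n : ℕ) (hα : 0 < α) (hβ : 0 < β) :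
    Matrix.vecMul (configWeight (n := n) α β q) (asepGenerator n α β 0 0 q) = 0 := by
  ext η
  rw [asepGenerator, vecMul_generator, sum_mul_transitionRate, sum_transitionRate]
  cases n with
  | zero => simp
  | succ n =>
    have hjump : (∑ i, ∑ j, if η j = true ∧ η i = false then
          asepJump (n + 1) q i j * configWeight α β q (η ∘ Equiv.swap i j) else 0) -
        configWeight α β q η *
          (∑ i, ∑ j, if η i = true ∧ η j = false then asepJump (n + 1) q i j else 0) =
        (if η 0 = true then -1 else 1) * configWeight α β q (η ∘ (0 : Fin (n + 1)).succAbove) -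
          (if η (Fin.last n) = true then -1 else 1) *
            configWeight α β q (η ∘ (Fin.last n).succAbove) := by
      have e := sum_asepJump_mul q fun i j : Fin (n + 1) =>
        (if η j = true ∧ η i = false then configWeight α β q (η ∘ Equiv.swap i j) else 0) -
          if η i = true ∧ η j = false then configWeight α β q η else 0
      simp only [configWeight_bond] at e
      have tel : ∀ g : Fin (n + 1) → ℝ, ∑ k : Fin n, (g k.castSucc - g k.succ) =
          g 0 - g (Fin.last n) := fun g => by
        have h1 := Fin.sum_univ_castSucc g
        rw [Fin.sum_univ_succ] at h1
        rw [Finset.sum_sub_distrib]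
        linarith
      rw [tel fun p => (if η p = true then -1 else 1) *
        configWeight α β q (η ∘ p.succAbove)] at e
      rw [← e, Finset.mul_sum, ← Finset.sum_sub_distrib]
      refine Finset.sum_congr rfl fun i _ => ?_
      rw [Finset.mul_sum, ← Finset.sum_sub_distrib]
      refine Finset.sum_congr rfl fun j _ => ?_
      rw [mul_sub, mul_ite, mul_ite, mul_ite, mul_zero, mul_zero,
        mul_comm (configWeight α β q η)]
    have hbirth : (∑ i, if η i = true then
          asepBirth (n + 1) α 0 i * configWeight α β q (Function.update η i false) else 0) -
        configWeight α β q η * (∑ i, if η i = false then asepBirth (n + 1) α 0 i else 0) =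
        -((if η 0 = true then -1 else 1) *
          configWeight α β q (η ∘ (0 : Fin (n + 1)).succAbove)) := by
      rw [← configWeight_left hα, Finset.sum_eq_single 0, Finset.sum_eq_single 0]
      · simp [asepBirth_zero, mul_comm]
      all_goals simp +contextual [asepBirth_zero]
    have hdeath : (∑ i, if η i = false then
          asepDeath (n + 1) β 0 i * configWeight α β q (Function.update η i true) else 0) -
        configWeight α β q η * (∑ i, if η i = true then asepDeath (n + 1) β 0 i else 0) =
        (if η (Fin.last n) = true then -1 else 1) *
          configWeight α β q (η ∘ (Fin.last n).succAbove) := by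
      rw [← configWeight_right hβ, Finset.sum_eq_single (Fin.last n),
        Finset.sum_eq_single (Fin.last n)]
      · simp [asepDeath_zero, mul_comm]
      all_goals simp +contextual [asepDeath_zero]
    rw [Pi.zero_apply]
    linarith

theorem permWeight_nonneg (hα : 0 < α) (hβ : 0 < β) (hq : 0 ≤ q)
    (π : Equiv.Perm (Fin (n + 1))) : 0 ≤ permWeight α β q π := by
  unfold permWeight
  positivity

theorem configWeight_nonneg (hα : 0 < α) (hβ : 0 < β) (hq : 0 ≤ q) (η : Config n) :
    0 ≤ configWeight α β q η :=
  Finset.sum_nonneg fun π _ => by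
    split_ifs
    · exact permWeight_nonneg hα hβ hq π
    · exact le_rfl

/-- A configuration with first site occupied and last site vacant has a particle directly followed
by a hole, so one of the three recursions applies. The `q` term is only nonnegative; the shorter
configurations give strict positivity. -/
theorem configWeight_pos (hα : 0 < α) (hβ : 0 < β) (hq : 0 ≤ q) (η : Config n) :
    0 < configWeight α β q η := by
  induction n with
  | zero =>
    refine Finset.sum_pos (fun π _ => ?_) Finset.univ_nonempty
    rw [if_pos (Subsingleton.elim _ _), permWeight]
    have : yinYang π = 0 := by
      rw [yinYang, Finset.card_eq_zero, Finset.filter_eq_empty_iff]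
      exact fun ij => ij.1.elim0
    rw [this, pow_zero]
    positivity
  | succ n ih =>
    by_cases h0 : η 0 = false
    · refine pos_of_mul_pos_right (a := α) ?_ hα.le
      rw [configWeight_zero_left hα h0]
      exact ih _
    by_cases h1 : η (Fin.last n) = true
    · refine pos_of_mul_pos_right (a := β) ?_ hβ.le
      rw [configWeight_last_true hβ h1]
      exact ih _
    obtain ⟨k, hk, hk'⟩ : ∃ k : Fin n, η k.castSucc = true ∧ η k.succ = false := by
      by_contra! hc
      refine h1 (Fin.induction (motive := fun i => η i = true) (by simpa using h0)
        (fun k hk => by simpa using hc k hk) _)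
    rw [configWeight_true_false hk hk']
    have := mul_nonneg hq (configWeight_nonneg hα hβ hq (η ∘ Equiv.swap k.castSucc k.succ))
    have := ih (η ∘ k.castSucc.succAbove)
    have := ih (η ∘ k.succ.succAbove)
    linarith

end Stationary

/-! ### Uniqueness -/

section Uniqueness

variable {n : ℕ} {Q : Fin n → Fin n → ℝ} {b d : Fin n → ℝ}

theorem transitionRate_nonneg (hQ : ∀ i j, 0 ≤ Q i j) (hb : ∀ i, 0 ≤ b i) (hd : ∀ i, 0 ≤ d i)
    (η η' : Config n) : 0 ≤ transitionRate Q b d η η' := by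
  refine add_nonneg (add_nonneg (Finset.sum_nonneg fun i _ => Finset.sum_nonneg fun j _ => ?_)
    (Finset.sum_nonneg fun i _ => ?_)) (Finset.sum_nonneg fun i _ => ?_)
  · split_ifs
    exacts [hQ i j, le_rfl]
  · split_ifs
    exacts [hb i, le_rfl]
  · split_ifs
    exacts [hd i, le_rfl]

theorem transitionRate_jump_pos (hQ : ∀ i j, 0 ≤ Q i j) (hb : ∀ i, 0 ≤ b i) (hd : ∀ i, 0 ≤ d i)
    {η : Config n} {i j : Fin n} (hi : η i = true) (hj : η j = false) (hij : 0 < Q i j) :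
    0 < transitionRate Q b d η (η ∘ Equiv.swap i j) := by
  have h0 : ∀ i' j' : Fin n, 0 ≤ if η i' = true ∧ η j' = false ∧
      η ∘ Equiv.swap i j = η ∘ Equiv.swap i' j' then Q i' j' else 0 := fun i' j' => by
    split_ifs
    exacts [hQ i' j', le_rfl]
  refine add_pos_of_pos_of_nonneg (add_pos_of_pos_of_nonneg ?_ (Finset.sum_nonneg fun i _ => ?_))
    (Finset.sum_nonneg fun i _ => ?_)
  · refine Finset.sum_pos' (fun i' _ => Finset.sum_nonneg fun j' _ => h0 i' j')
      ⟨i, Finset.mem_univ _, Finset.sum_pos' (fun j' _ => h0 i j') ⟨j, Finset.mem_univ _, ?_⟩⟩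
    rwa [if_pos ⟨hi, hj, rfl⟩]
  · split_ifs
    exacts [hb i, le_rfl]
  · split_ifs
    exacts [hd i, le_rfl]

theorem transitionRate_birth_pos (hQ : ∀ i j, 0 ≤ Q i j) (hb : ∀ i, 0 ≤ b i) (hd : ∀ i, 0 ≤ d i)
    {η : Config n} {i : Fin n} (hi : η i = false) (hbi : 0 < b i) :
    0 < transitionRate Q b d η (Function.update η i true) := by
  refine add_pos_of_pos_of_nonneg (add_pos_of_nonneg_of_pos
    (Finset.sum_nonneg fun i _ => Finset.sum_nonneg fun j _ => ?_) ?_)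
    (Finset.sum_nonneg fun i _ => ?_)
  · split_ifs
    exacts [hQ i j, le_rfl]
  · refine Finset.sum_pos' (fun i' _ => ?_) ⟨i, Finset.mem_univ _, ?_⟩
    · split_ifs
      exacts [hb i', le_rfl]
    · rwa [if_pos ⟨hi, rfl⟩]
  · split_ifs
    exacts [hd i, le_rfl]

theorem asepJump_nonneg {q : ℝ} (hq : 0 ≤ q) (i j : Fin n) : 0 ≤ asepJump n q i j := by
  unfold asepJump
  split_ifs <;> positivity

theorem asepBirth_nonneg {α δ : ℝ} (hα : 0 ≤ α) (hδ : 0 ≤ δ) (i : Fin n) :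
    0 ≤ asepBirth n α δ i := by
  unfold asepBirth
  split_ifs <;> positivity

theorem asepDeath_nonneg {β γ : ℝ} (hβ : 0 ≤ β) (hγ : 0 ≤ γ) (i : Fin n) :
    0 ≤ asepDeath n β γ i := by
  unfold asepDeath
  split_ifs <;> positivity

variable {α β q : ℝ}

/-- Every configuration can be reached from the empty one. -/
theorem empty_of_closed (hα : 0 < α) (hβ : 0 < β) (hq : 0 ≤ q) {p : Config n → Prop}
    (hp : ∀ η η', p η → 0 < transitionRate (asepJump n q) (asepBirth n α 0) (asepDeath n β 0) η' η →
      p η') (η : Config n) (hη : p η) : p fun _ => false := by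
  -- Trace the dynamics backwards on the leftmost particle: undo its birth, or the unit-rate jump
  -- that brought it. The sum of the occupied labels decreases; counting labels from one makes
  -- removal at the first site decrease it too.
  induction hm : ∑ i, (if η i = true then (i : ℕ) + 1 else 0) using Nat.strong_induction_on
    generalizing η with
  | _ m ih =>
    by_cases hex : ∃ i, η i = true
    · obtain ⟨i, hi, hmin⟩ : ∃ i, η i = true ∧ ∀ j, η j = true → i ≤ j := by
        obtain ⟨i, hi⟩ := hex
        have hne : (Finset.univ.filter fun i => η i = true).Nonempty := ⟨i, by simpa using hi⟩
        refine ⟨_, by simpa using Finset.min'_mem _ hne, fun j hj => Finset.min'_le _ _ ?_⟩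
        simpa using hj
      have hQ0 := fun i j : Fin n => asepJump_nonneg hq i j
      have hb0 := fun i : Fin n => asepBirth_nonneg hα.le le_rfl i
      have hd0 := fun i : Fin n => asepDeath_nonneg hβ.le le_rfl i
      by_cases hi0 : (i : ℕ) = 0
      · have hη' : Function.update (Function.update η i false) i true = η := by
          simp [← hi]
        refine ih _ ?_ (Function.update η i false) (hp η _ hη ?_) rfl
        · rw [← hm]
          refine Finset.sum_lt_sum (fun j _ => ?_) ⟨i, Finset.mem_univ _, ?_⟩
          · by_cases hj : j = i
            · subst hj
              simp
            · simp [hj]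
          · simp [hi]
        · have h := transitionRate_birth_pos (η := Function.update η i false) (i := i) hQ0 hb0 hd0
            (by simp) (by rwa [asepBirth, if_pos hi0, ite_self, add_zero])
          rwa [hη'] at h
      · obtain ⟨j, hj⟩ : ∃ j : Fin n, (i : ℕ) = j + 1 :=
          ⟨⟨i - 1, by omega⟩, by simp only; omega⟩
        have hji : j < i := Fin.lt_def.2 (by omega)
        have hηj : η j = false := by
          by_contra hc
          exact (hmin j (by simpa using hc)).not_gt hji
        have hη' : (η ∘ Equiv.swap j i) ∘ Equiv.swap j i = η := by
          ext k
          simp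
        refine ih _ ?_ (η ∘ Equiv.swap j i) (hp η _ hη ?_) rfl
        · rw [← hm, ← Equiv.sum_comp (Equiv.swap j i)]
          simp only [Function.comp_apply, Equiv.swap_apply_self]
          refine Finset.sum_lt_sum (fun k _ => ?_) ⟨i, Finset.mem_univ _, ?_⟩
          · by_cases hk : k = j
            · subst hk
              simp [hηj]
            by_cases hk' : k = i
            · subst hk'
              simp only [hi, if_true, Equiv.swap_apply_right]
              omega
            · rw [Equiv.swap_apply_of_ne_of_ne hk hk']
          · simp only [hi, if_true, Equiv.swap_apply_right]
            omega
        · have h := transitionRate_jump_pos (η := η ∘ Equiv.swap j i) (i := j) (j := i) hQ0 hb0 hd0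
            (by simp [hi]) (by simp [hηj]) (by rw [asepJump, if_pos hj]; exact one_pos)
          rwa [hη'] at h
    · have : η = fun _ => false := by
        ext i
        simpa using fun h => hex ⟨i, h⟩
      exact this ▸ hη

/-- Maximum principle. With `c` the largest ratio of `ν` to `w`, the null vector `D = c • w - ν` is
nonnegative and vanishes somewhere. Where it vanishes, balance makes it vanish at every predecessor,
hence at the empty configuration, which identifies `c`. -/
theorem le_of_vecMul_eq_zero (hα : 0 < α) (hβ : 0 < β) (hq : 0 ≤ q) {w ν : Config n → ℝ}
    (hpos : ∀ η, 0 < w η) (hw : Matrix.vecMul w (asepGenerator n α β 0 0 q) = 0)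
    (hν : Matrix.vecMul ν (asepGenerator n α β 0 0 q) = 0) (η : Config n) :
    ν η ≤ ν (fun _ => false) / w (fun _ => false) * w η := by
  obtain ⟨η₀, hmax⟩ := Finite.exists_max fun η => ν η / w η
  set c := ν η₀ / w η₀ with hc
  set D : Config n → ℝ := c • w - ν with hD
  have hD0 : ∀ η, 0 ≤ D η := fun η => by
    have := (div_le_iff₀ (hpos η)).1 (hmax η)
    simpa [hD] using this
  have hDG : Matrix.vecMul D (asepGenerator n α β 0 0 q) = 0 := by
    rw [hD, Matrix.sub_vecMul, Matrix.smul_vecMul, hw, hν, smul_zero, sub_zero]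
  have hclosed : ∀ η η', D η = 0 →
      0 < transitionRate (asepJump n q) (asepBirth n α 0) (asepDeath n β 0) η' η →
      D η' = 0 := fun η η' h0 hr => by
    have e := congrFun hDG η
    rw [asepGenerator, vecMul_generator, h0, zero_mul, sub_zero, Pi.zero_apply,
      Finset.sum_eq_zero_iff_of_nonneg fun η' _ => mul_nonneg (hD0 η')
        (transitionRate_nonneg (asepJump_nonneg hq) (asepBirth_nonneg hα.le le_rfl)
          (asepDeath_nonneg hβ.le le_rfl) _ _)] at e
    exact (mul_eq_zero.1 (e η' (Finset.mem_univ _))).resolve_right hr.ne'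
  have h0 : D η₀ = 0 := by
    simp [hD, hc, div_mul_cancel₀ _ (hpos η₀).ne']
  have he := empty_of_closed hα hβ hq (p := fun η => D η = 0) hclosed η₀ h0
  have hce : c = ν (fun _ => false) / w (fun _ => false) := by
    rw [eq_div_iff (hpos _).ne']
    simpa [hD, sub_eq_zero] using he
  rw [← hce]
  simpa [hD] using hD0 η

theorem eq_smul_of_vecMul_eq_zero (hα : 0 < α) (hβ : 0 < β) (hq : 0 ≤ q) {w ν : Config n → ℝ}
    (hpos : ∀ η, 0 < w η) (hw : Matrix.vecMul w (asepGenerator n α β 0 0 q) = 0)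
    (hν : Matrix.vecMul ν (asepGenerator n α β 0 0 q) = 0) :
    ν = (ν (fun _ => false) / w (fun _ => false)) • w := by
  ext η
  refine le_antisymm (le_of_vecMul_eq_zero hα hβ hq hpos hw hν η) ?_
  -- Applying the bound to `-ν` gives the opposite inequality with the same constant, both being
  -- evaluated at the empty configuration.
  have := le_of_vecMul_eq_zero hα hβ hq hpos hw (ν := -ν) (by rw [Matrix.neg_vecMul, hν, neg_zero]) η
  simp only [Pi.neg_apply, neg_div, neg_mul, Pi.smul_apply, smul_eq_mul] at this ⊢
  linarith

/-- A stationary distribution is the normalized `configWeight`. -/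
theorem isStationary_iff (hα : 0 < α) (hβ : 0 < β) (hq : 0 ≤ q) {μ : Config n → ℝ} :
    IsStationary (asepGenerator n α β 0 0 q) μ ↔
      μ = (∑ η : Config n, configWeight α β q η)⁻¹ • configWeight α β q := by
  have hpos := configWeight_pos (n := n) hα hβ hq
  have hw := vecMul_configWeight (q := q) n hα hβ
  have hZ : 0 < ∑ η : Config n, configWeight α β q η :=
    Finset.sum_pos (fun η _ => hpos η) Finset.univ_nonempty
  constructor
  · rintro ⟨⟨-, hsum⟩, hμ⟩
    have e := eq_smul_of_vecMul_eq_zero hα hβ hq hpos hw hμ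
    generalize μ (fun _ => false) / configWeight α β q (fun _ => false) = c at e
    subst e
    simp only [Pi.smul_apply, smul_eq_mul, ← Finset.mul_sum] at hsum
    rw [eq_inv_of_mul_eq_one_left hsum]
  · rintro rfl
    refine ⟨⟨fun η => ?_, ?_⟩, ?_⟩
    · exact mul_nonneg (inv_nonneg.2 hZ.le) (hpos η).le
    · simp only [Pi.smul_apply, smul_eq_mul, ← Finset.mul_sum]
      exact inv_mul_cancel₀ hZ.ne'
    · rw [Matrix.smul_vecMul, hw, smul_zero]

end Uniqueness

/-! ### Generating functions and conclusion -/

theorem permutationPolynomial_eq (n : ℕ) (α β q : ℝ) :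
    permutationPolynomial n α β q = partitionFunction (configWeight (n := n) α β q) := by
  simp only [permutationPolynomial, partitionFunction, configWeight, map_sum, Finset.sum_mul]
  rw [Finset.sum_comm]
  refine Finset.sum_congr rfl fun π _ => ?_
  rw [Finset.sum_eq_single (excConfig π)]
  · rw [if_pos rfl, permWeight, excedanceSet, Finset.prod_filter]
    congr 1
    refine Finset.prod_congr rfl fun i _ => ?_
    by_cases h : i.castSucc < π i.castSucc <;> simp [excConfig, h]
  · intro η _ hη
    rw [if_neg hη.symm, map_zero, zero_mul]
  · simp

theorem partitionFunction_smul {n : ℕ} (c : ℝ) (w : Config n → ℝ) :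
    partitionFunction (c • w) = MvPolynomial.C c * partitionFunction w := by
  simp only [partitionFunction, Finset.mul_sum, Pi.smul_apply, smul_eq_mul, map_mul, mul_assoc]

end ExclusionProcess

end

theorem mainTheorem2 (n : ℕ) (α β q : ℝ) (hα : 0 < α) (hβ : 0 < β) (hq : 0 ≤ q) :
    (∃! μ : ExclusionProcess.Config n → ℝ,
      ExclusionProcess.IsStationary (ExclusionProcess.asepGenerator n α β 0 0 q) μ) ∧
    ∀ μ : ExclusionProcess.Config n → ℝ,
      ExclusionProcess.IsStationary (ExclusionProcess.asepGenerator n α β 0 0 q) μ →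
        ∃ C : ℝ, 0 < C ∧
          ExclusionProcess.partitionFunction μ =
            MvPolynomial.C C * ExclusionProcess.permutationPolynomial n α β q := by
  refine ⟨⟨_, (ExclusionProcess.isStationary_iff hα hβ hq).2 rfl, fun μ hμ =>
    (ExclusionProcess.isStationary_iff hα hβ hq).1 hμ⟩, fun μ hμ => ?_⟩
  rw [ExclusionProcess.isStationary_iff hα hβ hq] at hμ
  have hZ : 0 < ∑ η : ExclusionProcess.Config n, ExclusionProcess.configWeight α β q η :=
    Finset.sum_pos (fun η _ => ExclusionProcess.configWeight_pos hα hβ hq η) Finset.univ_nonempty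
  refine ⟨_, inv_pos.2 hZ, ?_⟩
  rw [hμ, ExclusionProcess.partitionFunction_smul, ExclusionProcess.permutationPolynomial_eq]
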